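/- **Setting.** Let $\alpha>2$, $d>0$, $\lambda>0$, $m_I>0$ be real and $m_D\ge 1$ an integer. The interferer locations $\{x_i\}_{i\ge 0}$ form a stationary Poisson point process of density $\lambda$ in $\mathbb{R}^2$. The fading gains $g_1,g_2$ (desired links) and $h_{n,i}$ ($n\in\{1,2\}$, $i\ge 0$; interfering links) are mutually independent and independent of the interferer locations. Each $g_n$ is Gamma distributed with shape $m_D$ and scale $1/m_D$, and each $h_{n,i}$ is Gamma distributed with shape $m_I$ and scale $1/m_I$. The interference at antenna $n$ is $I_n = d^{\alpha}\sum_i h_{n,i}\|x_i\|^{-\alpha}$. In the absence of noise the success probability of dual-branch maximal-ratio combining (MRC) with threshold $T>0$ is $$P_{\mathrm{MRC}}(T)=\mathbb{P}\left(\frac{g_1}{I_1}+\frac{g_2}{I_2}\ge T\right).$$ Put $\kappa=\pi\lambda d^2(m_D/m_I)^{2/\alpha}$, $B(a,b)=\Gamma(a)\Gamma(b)/\Gamma(a+b)$, and for $0\le k<m_D$ $$C_k=\int_0^1 u^{2/\alpha-1-k}(1-u)^k\,{}_2\mathbf{F}_1\left(-\tfrac{2}{\alpha}+m_D+k,\;m_I+k;\;2m_I+m_D+k;\;\tfrac{2u-1}{u}\right)du,$$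 where ${}_2\mathbf{F}_1(a,b;c;z)={}_2F_1(a,b;c;z)/\Gamma(c)$ is the regularized Gauss hypergeometric function (analytically continued to $z<1$). **Statement.** The integrals $C_k$ converge absolutely and, as $T\to 0^+$, $$P_{\mathrm{MRC}}(T)\sim 1-\kappa T^{2/\alpha}\frac{\Gamma(m_D-\frac{2}{\alpha})\Gamma(m_I+\frac{2}{\alpha})}{\Gamma(m_I)\Gamma(m_D)}+\frac{2}{\alpha}\kappa T^{2/\alpha}\frac{\Gamma(2m_I+\frac{2}{\alpha})}{B(m_I,m_D)}\sum_{k=0}^{m_D-1}\frac{\Gamma(-\frac{2}{\alpha}+m_D+k)\,C_k}{B(m_I,k+1)(m_I+k)}.$$ This holds both for the success probability itself (the ratio of the two sides tends to $1$) and for the outage probability: $$1-P_{\mathrm{MRC}}(T)\sim \kappa T^{2/\alpha}\left[\frac{\Gamma(m_D-\frac{2}{\alpha})\Gamma(m_I+\frac{2}{\alpha})}{\Gamma(m_I)\Gamma(m_D)}-\frac{2}{\alpha}\,\frac{\Gamma(2m_I+\frac{2}{\alpha})}{B(m_I,m_D)}\sum_{k=0}^{m_D-1}\frac{\Gamma(-\frac{2}{\alpha}+m_D+k)\,C_k}{B(m_I,k+1)(m_I+k)}\right].$$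 -/

import Mathlib

open MeasureTheory ProbabilityTheory Filter Topology Asymptotics
open scoped ENNReal NNReal

namespace DualMRC

noncomputable section

/-! ### Special functions -/

/-- Gauss's hypergeometric function `₂F₁(a, b; c; x)` for real `x < 1`: the power series inside the
unit disc, and outside of it its analytic continuation to `x ≤ -1`, which is given by the Pfaff
transformation `₂F₁(a, b; c; x) = (1 - x) ^ (-a) ₂F₁(a, c - b; c; x / (x - 1))`
(for `x ≤ -1` one has `x / (x - 1) ∈ [1/2, 1)`). Only values at `x < 1` are meaningful. -/
def gaussHyp (a b c x : ℝ) : ℝ :=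
  if |x| < 1 then ordinaryHypergeometric a b c x
  else (1 - x) ^ (-a) * ordinaryHypergeometric a (c - b) c (x / (x - 1))

/-- The regularized hypergeometric function `₂F₁(a, b; c; x) / Γ(c)`. -/
def regGaussHyp (a b c x : ℝ) : ℝ := gaussHyp a b c x / Real.Gamma c

/-- The integrand of `C_k`. -/
def coeffIntegrand (α mI : ℝ) (mD k : ℕ) (u : ℝ) : ℝ :=
  u ^ (2 / α - 1 - (k : ℝ)) * (1 - u) ^ k *
    regGaussHyp (-(2 / α) + mD + k) (mI + k) (2 * mI + mD + k) ((2 * u - 1) / u)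

/-- `C_k = ∫₀¹ u^{2/α-1-k} (1-u)^k ₂𝐅₁(-2/α+m_D+k, m_I+k; 2m_I+m_D+k; (2u-1)/u) du`. -/
def coeffC (α mI : ℝ) (mD k : ℕ) : ℝ :=
  ∫ u in Set.Ioo (0 : ℝ) 1, coeffIntegrand α mI mD k u

/-- `κ = π λ d² (m_D / m_I)^{2/α}`. -/
def kappa (lam d α mI : ℝ) (mD : ℕ) : ℝ :=
  Real.pi * lam * d ^ 2 * ((mD : ℝ) / mI) ^ (2 / α)

/-- The single-antenna outage term `κ T^{2/α} Γ(m_D-2/α) Γ(m_I+2/α) / (Γ(m_I) Γ(m_D))`. -/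
def singleAntennaTerm (lam d α mI : ℝ) (mD : ℕ) (T : ℝ) : ℝ :=
  kappa lam d α mI mD * T ^ (2 / α) *
    (Real.Gamma (mD - 2 / α) * Real.Gamma (mI + 2 / α) / (Real.Gamma mI * Real.Gamma mD))

/-- The dual-branch gain term
`(2/α) κ T^{2/α} Γ(2m_I+2/α)/B(m_I,m_D) ∑_{k<m_D} Γ(-2/α+m_D+k) C_k / (B(m_I,k+1) (m_I+k))`. -/
def dualBranchGain (lam d α mI : ℝ) (mD : ℕ) (T : ℝ) : ℝ :=
  2 / α * kappa lam d α mI mD * T ^ (2 / α) *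
    (Real.Gamma (2 * mI + 2 / α) / beta mI mD) *
    ∑ k ∈ Finset.range mD,
      Real.Gamma (-(2 / α) + mD + k) * coeffC α mI mD k / (beta mI (k + 1) * (mI + k))

/-! ### The stochastic model -/

variable {Ω : Type*} [MeasurableSpace Ω]

/-- The number of indices `i` whose point `x i` falls in `A`. -/
def pointCount {E : Type*} (x : ℕ → Ω → E) (A : Set E) (ω : Ω) : ℕ∞ :=
  {i : ℕ | x i ω ∈ A}.encard

/-- The random points `x 0, x 1, …` form a Poisson point process with intensity measure `Λ`: the
number of points in a measurable set of finite intensity is Poisson distributed, and the numbers of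
points in disjoint such sets are independent. -/
structure IsPoissonPointProcess {E : Type*} [MeasurableSpace E] (P : Measure Ω)
    (x : ℕ → Ω → E) (Λ : Measure E) : Prop where
  measurable : ∀ i, Measurable (x i)
  count_law : ∀ A : Set E, MeasurableSet A → Λ A ≠ ∞ →
    HasLaw (pointCount x A) ((poissonMeasure (Λ A).toNNReal).map (Nat.cast : ℕ → ℕ∞)) P
  count_indep : ∀ (n : ℕ) (A : Fin n → Set E), (∀ j, MeasurableSet (A j)) →
    (∀ j, Λ (A j) ≠ ∞) → Pairwise (Function.onFun Disjoint A) →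
    iIndepFun (fun j => pointCount x (A j)) P

/-- The network with `N` receive antennas at the origin. `x i` is the location of interferer `i`,
`g n` the power fading gain from the desired transmitter to antenna `n`, and `h n i` the power
fading gain from interferer `i` to antenna `n`. The interferers form a stationary planar Poisson
point process of density `lam`; all gains are gamma distributed with mean `1`, with shape `mD`
(desired links) or `mI` (interfering links); all gains are mutually independent and independent of
the interferer locations. -/
structure IsNetwork (P : Measure Ω) (N : ℕ) (lam mI : ℝ) (mD : ℕ)
    (x : ℕ → Ω → EuclideanSpace ℝ (Fin 2)) (g : Fin N → Ω → ℝ) (h : Fin N → ℕ → Ω → ℝ) :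
    Prop where
  poisson : IsPoissonPointProcess P x (ENNReal.ofReal lam • volume)
  measurable_g : ∀ n, Measurable (g n)
  measurable_h : ∀ n i, Measurable (h n i)
  law_g : ∀ n, HasLaw (g n) (gammaMeasure mD mD) P
  law_h : ∀ n i, HasLaw (h n i) (gammaMeasure mI mI) P
  indep_fading : iIndepFun
    (fun (j : Fin N ⊕ (Fin N × ℕ)) ω => Sum.elim (fun n => g n ω) (fun p => h p.1 p.2 ω) j) P
  indep_locations : IndepFun (fun ω i => x i ω)
    (fun ω (j : Fin N ⊕ (Fin N × ℕ)) =>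
      Sum.elim (fun n => g n ω) (fun p => h p.1 p.2 ω) j) P

/-- Normalized interference power `I_n = d^α ∑_i h_{n,i} ‖x_i‖^{-α}` at an antenna with interferer
gains `hn`, as an element of `[0, ∞]`. -/
def interference (d α : ℝ) (x : ℕ → Ω → EuclideanSpace ℝ (Fin 2)) (hn : ℕ → Ω → ℝ) (ω : Ω) :
    ℝ≥0∞ :=
  ENNReal.ofReal (d ^ α) * ∑' i, ENNReal.ofReal (hn i ω) * ‖x i ω‖ₑ ^ (-α)

/-- Post-combiner `SINR` of `N`-branch MRC, `∑_n g_n / (I_n + SNR⁻¹)`. The average signal-to-noise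
ratio takes values in `[0, ∞]`; absence of noise is `SNR = ∞`, for which `SNR⁻¹ = 0`. -/
def sinrMRC {N : ℕ} (SNR : ℝ≥0∞) (d α : ℝ) (x : ℕ → Ω → EuclideanSpace ℝ (Fin 2))
    (g : Fin N → Ω → ℝ) (h : Fin N → ℕ → Ω → ℝ) (ω : Ω) : ℝ≥0∞ :=
  ∑ n, ENNReal.ofReal (g n ω) / (interference d α x (h n) ω + SNR⁻¹)

/-- Success probability `P_MRC = ℙ(SINR_MRC ≥ T)`. -/
def successProb {N : ℕ} (P : Measure Ω) (SNR : ℝ≥0∞) (d α : ℝ)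
    (x : ℕ → Ω → EuclideanSpace ℝ (Fin 2)) (g : Fin N → Ω → ℝ) (h : Fin N → ℕ → Ω → ℝ)
    (T : ℝ) : ℝ :=
  P.real {ω | ENNReal.ofReal T ≤ sinrMRC SNR d α x g h ω}

end

end DualMRC

namespace DualMRC

/-! ### Changes of variables on the half-line -/

/-! Write `δ = 2/α`. At a small threshold, outage is to leading order caused by a single strong
interferer. Given the scaled pair `s = (T I₁, T I₂)`, the outage probability is `condOutage s =
ℙ(g₁/s₁ + g₂/s₂ < 1)`, a continuous function on the compact space `[0, ∞]²`. The laws of `s`,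
multiplied by `T^(-δ)`, converge away from the origin to `λ d²` times `pairIntensity`, the intensity
of the pairs of powers received from single points.

The convergence is proved by Laplace transforms. The Laplace functional of the marked Poisson
process and a dilation of the plane give the transform at `(j, k)` exactly, as `exp (-T^δ c)` with
`c` independent of `T` (`integral_expNeg_interferencePair`). Differences of these transforms handle
test functions `f(s) (1 - exp (-(s₁ + s₂)))` with `f` a polynomial in `exp (-s₁)` and `exp (-s₂)`;
Stone–Weierstrass extends this to all continuous `f` (`tendsto_of_tendsto_laplace`). `condOutage`
has this form because it is bounded by a multiple of `(1 - exp (-s₁)) (1 - exp (-s₂))`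
(`exists_condOutage_le`), so that the quotient extends continuously by zero at the origin. Hence
`T^(-δ)` times the outage probability converges to `λ d² ∫ condOutage` (`tendsto_outage`).

For the limit, integrate over the plane first: a disc area turns the integral into `π` times the
moment of order `-δ` of a sum of two independent gamma ratios (`integral_condOutage_pairIntensity`).
By the layer-cake formula, this moment is the single-ratio moment minus a correction involving the
tail of the second ratio. For integer `m_D` that tail is a finite sum, and in the coordinates `v =
su`, `w = s(1-u)` each summand is Euler's integral in `s` followed by the integral `C_k` in `u`. As
all terms are nonnegative and the single-ratio moment is finite, convergence of every `C_k` comes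
for free (`lintegral_sum_ratio_rpow_neg`). The limit is positive, which turns convergence into
asymptotic equivalence. -/

theorem lintegral_Ioi_eq_lintegral_Ioo (f : ℝ → ℝ≥0∞) :
    ∫⁻ v in Set.Ioi (0 : ℝ), f v =
      ∫⁻ y in Set.Ioo (0 : ℝ) 1, ENNReal.ofReal (1 / (1 - y) ^ 2) * f (y / (1 - y)) := by
  have himg : (fun y : ℝ => y / (1 - y)) '' Set.Ioo 0 1 = Set.Ioi 0 := by
    ext v
    constructor
    · rintro ⟨y, ⟨h0, h1⟩, rfl⟩
      exact div_pos h0 (by linarith)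
    · intro hv
      have hv' : (0 : ℝ) < v := hv
      refine ⟨v / (1 + v), ⟨by positivity, by rw [div_lt_one (by positivity)]; linarith⟩, ?_⟩
      field_simp
      ring
  have hinj : Set.InjOn (fun y : ℝ => y / (1 - y)) (Set.Ioo 0 1) := by
    rintro y ⟨-, hy⟩ z ⟨-, hz⟩ h
    have hy' : (1 - y) ≠ 0 := by linarith
    have hz' : (1 - z) ≠ 0 := by linarith
    simp only at h
    rw [div_eq_div_iff hy' hz'] at h
    linarith
  rw [← himg, lintegral_image_eq_lintegral_abs_deriv_mul (f' := fun y => 1 / (1 - y) ^ 2)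
    measurableSet_Ioo _ hinj]
  · refine setLIntegral_congr_fun measurableSet_Ioo fun y _ => ?_
    rw [abs_of_nonneg (by positivity)]
  · rintro y ⟨-, hy⟩
    have hy' : (1 - y) ≠ 0 := by linarith
    have := ((hasDerivAt_id y).div ((hasDerivAt_const y (1 : ℝ)).sub (hasDerivAt_id y)) hy')
    refine HasDerivAt.hasDerivWithinAt ?_
    convert! this using 1
    simp

theorem lintegral_Ioi_comp_mul_left {c : ℝ} (hc : 0 < c) (f : ℝ → ℝ≥0∞) :
    ∫⁻ v in Set.Ioi (0 : ℝ), f v = ENNReal.ofReal c * ∫⁻ s in Set.Ioi (0 : ℝ), f (c * s) := by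
  have himg : (fun s : ℝ => c * s) '' Set.Ioi 0 = Set.Ioi 0 := by
    ext v
    constructor
    · rintro ⟨y, h0, rfl⟩
      exact mul_pos hc h0
    · intro hv
      exact ⟨v / c, div_pos hv hc, by field_simp⟩
  have hinj : Set.InjOn (fun s : ℝ => c * s) (Set.Ioi 0) :=
    fun y _ z _ h => mul_left_cancel₀ hc.ne' h
  conv_lhs => rw [← himg]
  rw [lintegral_image_eq_lintegral_abs_deriv_mul (f' := fun _ => c)
    measurableSet_Ioi _ hinj, abs_of_pos hc, lintegral_const_mul' _ _ ENNReal.ofReal_ne_top]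
  intro y _
  simpa using ((hasDerivAt_id y).const_mul c).hasDerivWithinAt

/-! ### Euler's integral -/

theorem hasSum_one_sub_rpow_neg (b : ℝ) {x : ℝ} (hx : |x| < 1) :
    HasSum (fun n : ℕ => (ascPochhammer ℝ n).eval b / n.factorial * x ^ n) ((1 - x) ^ (-b)) := by
  have h := (Real.one_add_rpow_hasFPowerSeriesOnBall_zero (a := -b)).hasSum (y := -x)
    (by simpa [enorm_eq_nnnorm, ← NNReal.coe_lt_coe] using hx)
  -- The binomial series is `₂F₁` with equal second and third parameters; these cancel, and `1` is a
  -- convenient value.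
  rw [binomialSeries_eq_ordinaryHypergeometricSeries (b := 1)
    (fun k => by have : (0 : ℝ) ≤ k := k.cast_nonneg; linarith)] at h
  convert! h using 1
  · ext n
    simp only [FormalMultilinearSeries.compContinuousLinearMap_apply]
    have h1 : (⇑(-(ContinuousLinearMap.id ℝ ℝ)) ∘ fun _ : Fin n => -x) = fun _ => x := by
      ext; simp
    rw [h1, ordinaryHypergeometricSeries_apply_eq, neg_neg, mul_inv_cancel_right₀, smul_eq_mul]
    · ring
    · exact (ascPochhammer_pos n (1 : ℝ) one_pos).ne'
  · simp [sub_eq_add_neg]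

theorem setLIntegral_beta {a b : ℝ} (ha : 0 < a) (hb : 0 < b) :
    ∫⁻ t in Set.Ioo (0 : ℝ) 1, ENNReal.ofReal (t ^ (a - 1) * (1 - t) ^ (b - 1)) =
      ENNReal.ofReal (beta a b) := by
  have h := lintegral_betaPDF_eq_one ha hb
  have hB := beta_pos ha hb
  rw [lintegral_betaPDF] at h
  have : ∀ t : ℝ, ENNReal.ofReal (1 / beta a b * t ^ (a - 1) * (1 - t) ^ (b - 1)) =
      ENNReal.ofReal (1 / beta a b) * ENNReal.ofReal (t ^ (a - 1) * (1 - t) ^ (b - 1)) := by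
    intro t
    rw [mul_assoc, ENNReal.ofReal_mul (by positivity)]
  simp_rw [this] at h
  rw [lintegral_const_mul' _ _ ENNReal.ofReal_ne_top, one_div, ENNReal.ofReal_inv_of_pos hB] at h
  rw [ENNReal.eq_inv_of_mul_eq_one_left ((mul_comm _ _).trans h), inv_inv]

theorem integrableOn_beta {a b : ℝ} (ha : 0 < a) (hb : 0 < b) :
    IntegrableOn (fun t : ℝ => t ^ (a - 1) * (1 - t) ^ (b - 1)) (Set.Ioo 0 1) := by
  refine ⟨by fun_prop, ?_⟩
  rw [hasFiniteIntegral_iff_ofReal, setLIntegral_beta ha hb]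
  · exact ENNReal.ofReal_lt_top
  · refine (ae_restrict_iff' measurableSet_Ioo).2 (ae_of_all _ fun t ht => ?_)
    have := ht.1
    have : 0 < 1 - t := by linarith [ht.2]
    simp only [Pi.zero_apply]
    positivity

theorem setIntegral_beta {a b : ℝ} (ha : 0 < a) (hb : 0 < b) :
    ∫ t in Set.Ioo (0 : ℝ) 1, t ^ (a - 1) * (1 - t) ^ (b - 1) = beta a b := by
  rw [integral_eq_lintegral_of_nonneg_ae, setLIntegral_beta ha hb,
    ENNReal.toReal_ofReal (beta_pos ha hb).le]
  · refine (ae_restrict_iff' measurableSet_Ioo).2 (ae_of_all _ fun t ht => ?_)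
    have := ht.1
    have : 0 < 1 - t := by linarith [ht.2]
    simp only [Pi.zero_apply]
    positivity
  · fun_prop

theorem Gamma_add_nat {z : ℝ} (hz : 0 < z) (n : ℕ) :
    Real.Gamma (z + n) = (ascPochhammer ℝ n).eval z * Real.Gamma z := by
  induction n with
  | zero => simp
  | succ n ih =>
    rw [Nat.cast_succ, ← add_assoc, Real.Gamma_add_one (by positivity), ih,
      ascPochhammer_succ_eval]
    ring

theorem beta_add_nat {a d : ℝ} (ha : 0 < a) (hd : 0 < d) (n : ℕ) :
    beta (a + n) d = beta a d * ((ascPochhammer ℝ n).eval a *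
      ((ascPochhammer ℝ n).eval (a + d))⁻¹) := by
  rw [beta, beta, show a + n + d = a + d + n by ring, Gamma_add_nat ha,
    Gamma_add_nat (add_pos ha hd)]
  field_simp

/-- Expand `(1 - xt)^(-b)` in its binomial series and integrate term by term; the beta integrals
supply the remaining Pochhammer quotients. The exchange is justified by `beta (a + n) d ≤ beta a d`
and convergence of the series at `|x|`. -/
theorem setLIntegral_euler {a b d x : ℝ} (ha : 0 < a) (hb : 0 < b) (hd : 0 < d) (hx : |x| < 1) :
    ∫⁻ t in Set.Ioo (0 : ℝ) 1,
      ENNReal.ofReal (t ^ (a - 1) * (1 - t) ^ (d - 1) * (1 - x * t) ^ (-b)) =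
      ENNReal.ofReal (beta a d * ordinaryHypergeometric a b (a + d) x) := by
  have hxt : ∀ t ∈ Set.Ioo (0 : ℝ) 1, |x * t| ≤ |x| := fun t ht => by
    rw [abs_mul, abs_of_pos ht.1]
    exact mul_le_of_le_one_right (abs_nonneg _) ht.2.le
  set c : ℕ → ℝ := fun n => (ascPochhammer ℝ n).eval b / n.factorial with hc
  have hc0 : ∀ n, 0 ≤ c n := fun n => div_nonneg (ascPochhammer_pos n b hb).le (by positivity)
  let F : ℕ → ℝ → ℝ := fun n t => c n * x ^ n * (t ^ (a + n - 1) * (1 - t) ^ (d - 1))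
  have han : ∀ n : ℕ, 0 < a + n := fun n => by positivity
  have hFint : ∀ n, Integrable (F n) (volume.restrict (Set.Ioo 0 1)) := fun n =>
    (integrableOn_beta (han n) hd).const_mul _
  have hFval : ∀ n, ∫ t in Set.Ioo (0 : ℝ) 1, F n t = c n * x ^ n * beta (a + n) d := fun n => by
    simp only [F]
    rw [integral_const_mul, setIntegral_beta (han n) hd]
  have hbeta : ∀ n : ℕ, beta (a + n) d ≤ beta a d := fun n => by
    rw [← setIntegral_beta (han n) hd, ← setIntegral_beta ha hd]
    refine setIntegral_mono_on (integrableOn_beta (han n) hd) (integrableOn_beta ha hd)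
      measurableSet_Ioo fun t ht => ?_
    have h1 : 0 < 1 - t := by linarith [ht.2]
    refine mul_le_mul_of_nonneg_right ?_ (by positivity)
    exact Real.rpow_le_rpow_of_exponent_ge ht.1 ht.2.le
      (by have : (0 : ℝ) ≤ n := n.cast_nonneg
          linarith)
  have hnorm : ∀ n, ∫ t in Set.Ioo (0 : ℝ) 1, ‖F n t‖ =
      c n * |x| ^ n * beta (a + n) d := fun n => by
    rw [← setIntegral_beta (han n) hd, ← integral_const_mul]
    refine setIntegral_congr_fun measurableSet_Ioo fun t ht => ?_
    have h1 : 0 < 1 - t := by linarith [ht.2]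
    have h0 := ht.1
    simp only [F, norm_mul, Real.norm_eq_abs, abs_pow]
    rw [abs_of_nonneg (hc0 n), abs_of_nonneg (a := t ^ _) (by positivity),
      abs_of_nonneg (a := (1 - t) ^ _) (by positivity)]
  have hsum : Summable fun n => ∫ t in Set.Ioo (0 : ℝ) 1, ‖F n t‖ := by
    simp_rw [hnorm]
    refine Summable.of_nonneg_of_le
      (fun n => mul_nonneg (mul_nonneg (hc0 n) (by positivity)) (beta_pos (han n) hd).le)
      (fun n => mul_le_mul_of_nonneg_left (hbeta n) (mul_nonneg (hc0 n) (by positivity)))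
      ((hasSum_one_sub_rpow_neg b (x := |x|) (by simpa using hx)).summable.mul_right _)
  have htsum : ∀ t ∈ Set.Ioo (0 : ℝ) 1,
      ∑' n, F n t = t ^ (a - 1) * (1 - t) ^ (d - 1) * (1 - x * t) ^ (-b) := fun t ht => by
    have h := (hasSum_one_sub_rpow_neg b (x := x * t) ((hxt t ht).trans_lt hx)).mul_left
      (t ^ (a - 1) * (1 - t) ^ (d - 1))
    rw [← h.tsum_eq]
    refine tsum_congr fun n => ?_
    simp only [F, hc]
    rw [show a + n - 1 = a - 1 + n by ring, Real.rpow_add_natCast ht.1.ne', mul_pow]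
    ring
  have hmain := hasSum_integral_of_summable_integral_norm hFint hsum
  rw [setIntegral_congr_fun measurableSet_Ioo htsum] at hmain
  simp_rw [hFval] at hmain
  have hint : IntegrableOn (fun t : ℝ => t ^ (a - 1) * (1 - t) ^ (d - 1) * (1 - x * t) ^ (-b))
      (Set.Ioo 0 1) := by
    refine Integrable.mono' ((integrableOn_beta ha hd).mul_const ((1 - |x|) ^ (-b)))
      (by fun_prop) ((ae_restrict_iff' measurableSet_Ioo).2 (ae_of_all _ fun t ht => ?_))
    have h1 : 0 < 1 - t := by linarith [ht.2]
    have h0 := ht.1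
    have h2 : 1 - |x| ≤ 1 - x * t := by linarith [le_abs_self (x * t), hxt t ht]
    have h3 : 0 < 1 - |x| := by linarith
    have h4 : 0 < 1 - x * t := by linarith
    rw [Real.norm_of_nonneg (by positivity)]
    exact mul_le_mul_of_nonneg_left
      (Real.rpow_le_rpow_of_nonpos h3 h2 (by linarith)) (by positivity)
  rw [← ofReal_integral_eq_lintegral_ofReal hint]
  · congr 1
    rw [← hmain.tsum_eq, ordinaryHypergeometric_eq_tsum, ← tsum_mul_left]
    refine tsum_congr fun n => ?_
    rw [beta_add_nat ha hd, smul_eq_mul]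
    simp only [hc]
    ring
  · refine (ae_restrict_iff' measurableSet_Ioo).2 (ae_of_all _ fun t ht => ?_)
    have h1 : 0 < 1 - t := by linarith [ht.2]
    have h0 := ht.1
    have h4 : 0 < 1 - x * t := by linarith [le_abs_self (x * t), hxt t ht]
    simp only [Pi.zero_apply]
    positivity

/-- The substitution `s = t / (y (1 - t))` reduces this to `setLIntegral_euler` at `x = 1 - z / y`.
-/
theorem setLIntegral_rpow_mul_one_add_rpow {a p q y z : ℝ} (ha : 0 < a) (hq : 0 < q)
    (hpq : a < p + q) (hy : 0 < y) (hz : 0 < z) (hyz : |1 - z / y| < 1) :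
    ∫⁻ s in Set.Ioi (0 : ℝ),
      ENNReal.ofReal (s ^ (a - 1) * (1 + s * y) ^ (-p) * (1 + s * z) ^ (-q)) =
      ENNReal.ofReal (y ^ (-a) * (beta a (p + q - a) *
        ordinaryHypergeometric a q (p + q) (1 - z / y))) := by
  rw [ENNReal.ofReal_mul (by positivity)]
  have h := setLIntegral_euler ha hq (d := p + q - a) (by linarith) hyz
  rw [add_sub_cancel] at h
  rw [← h, lintegral_Ioi_comp_mul_left (inv_pos.2 hy), lintegral_Ioi_eq_lintegral_Ioo,
    ← lintegral_const_mul' _ _ ENNReal.ofReal_ne_top,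
    ← lintegral_const_mul' _ _ ENNReal.ofReal_ne_top]
  refine setLIntegral_congr_fun measurableSet_Ioo fun t ht => ?_
  have h1 : 0 < 1 - t := by linarith [ht.2]
  have h0 := ht.1
  have h2 : 0 < 1 - (1 - z / y) * t := by
    have : (1 - (1 - z / y) * t) = (1 - t) + z / y * t := by ring
    rw [this]
    positivity
  rw [← ENNReal.ofReal_mul (by positivity), ← ENNReal.ofReal_mul (by positivity),
    ← ENNReal.ofReal_mul (by positivity)]
  congr 1
  have e1 : 1 + y⁻¹ * (t / (1 - t)) * y = (1 - t)⁻¹ := by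
    field_simp
    ring
  have e2 : 1 + y⁻¹ * (t / (1 - t)) * z = (1 - (1 - z / y) * t) / (1 - t) := by
    field_simp
    ring
  rw [e1, e2, Real.mul_rpow (by positivity) (by positivity), Real.div_rpow h0.le h1.le,
    Real.div_rpow h2.le h1.le, Real.inv_rpow h1.le, Real.inv_rpow hy.le, ← Real.rpow_neg h1.le,
    neg_neg]
  have e3 : (1 - t) ^ (p + q - a - 1) = (1 - t) ^ p / ((1 - t) ^ (a - 1) * (1 - t) ^ (-q) *
      (1 - t) ^ 2) := by
    rw [eq_div_iff (by positivity), ← Real.rpow_natCast (1 - t) 2, ← Real.rpow_add h1,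
      ← Real.rpow_add h1, ← Real.rpow_add h1]
    congr 1
    push_cast
    ring
  have e4 : y ^ (-a) = y⁻¹ * (y ^ (a - 1))⁻¹ := by
    rw [← Real.rpow_neg hy.le, ← Real.rpow_neg_one, ← Real.rpow_add hy]
    congr 1
    ring
  rw [e3, e4]
  field_simp

/-- The integral representation of `gaussHyp` on the whole half-line `x < 1`. -/
theorem setLIntegral_eq_gaussHyp {a p q y z : ℝ} (ha : 0 < a) (hp : 0 < p) (hq : 0 < q)
    (hpq : a < p + q) (hy : 0 < y) (hz : 0 < z) :
    ∫⁻ s in Set.Ioi (0 : ℝ),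
      ENNReal.ofReal (s ^ (a - 1) * (1 + s * y) ^ (-p) * (1 + s * z) ^ (-q)) =
      ENNReal.ofReal (y ^ (-a) * (beta a (p + q - a) * gaussHyp a q (p + q) (1 - z / y))) := by
  unfold gaussHyp
  split_ifs with h
  · exact setLIntegral_rpow_mul_one_add_rpow ha hq hpq hy hz h
  -- The integral is symmetric under exchanging `(y, p)` with `(z, q)`. After the exchange the
  -- argument is `1 - y / z ∈ [1/2, 1)`, which is exactly the Pfaff-transformed argument.
  · have hzy : 2 ≤ z / y := by
      by_contra hlt
      have : 0 < z / y := by positivity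
      exact h (abs_lt.2 ⟨by linarith, by linarith⟩)
    have hyz : y / z ≤ 1 / 2 := by
      rw [le_div_iff₀ hy] at hzy
      rw [div_le_iff₀ hz]
      linarith
    have hyz0 : 0 < y / z := by positivity
    have := setLIntegral_rpow_mul_one_add_rpow ha hp (by linarith : a < q + p) hz hy
      (abs_lt.2 ⟨by linarith, by linarith⟩)
    rw [add_comm q p] at this
    have e1 : (1 - z / y) / (1 - z / y - 1) = 1 - y / z := by
      rw [div_eq_iff (by linarith)]
      field_simp
      ring
    have e2 : y ^ (-a) * (1 - (1 - z / y)) ^ (-a) = z ^ (-a) := by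
      rw [← Real.mul_rpow hy.le (by linarith)]
      congr 1
      field_simp
      ring
    rw [e1, add_sub_cancel_right]
    rw [← e2] at this
    convert this using 2
    · ext s
      rw [mul_right_comm]
    · ring

/-! ### Ratios of gamma variables -/

theorem lintegral_gammaMeasure {a r : ℝ} {f : ℝ → ℝ≥0∞} (hf : Measurable f) :
    ∫⁻ x, f x ∂gammaMeasure a r = ∫⁻ x in Set.Ioi (0 : ℝ),
      ENNReal.ofReal (r ^ a / Real.Gamma a * x ^ (a - 1) * Real.exp (-(r * x))) * f x := by
  have hm : Measurable (gammaPDF a r) := (measurable_gammaPDFReal a r).ennreal_ofReal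
  rw [gammaMeasure, lintegral_withDensity_eq_lintegral_mul _ hm hf,
    ← lintegral_add_compl _ (measurableSet_Ici (a := (0 : ℝ))), Set.compl_Ici,
    setLIntegral_eq_zero measurableSet_Iio, add_zero, setLIntegral_congr Ioi_ae_eq_Ici.symm]
  · refine setLIntegral_congr_fun measurableSet_Ioi fun x hx => ?_
    simp only [Pi.mul_apply]
    rw [gammaPDF_of_nonneg (le_of_lt hx)]
  · intro x hx
    simp [gammaPDF_of_neg hx]

theorem lintegral_gammaMeasure_comp_mul {a r : ℝ} (hr : 0 < r) {f : ℝ → ℝ≥0∞}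
    (hf : Measurable f) :
    ∫⁻ x, f (r * x) ∂gammaMeasure a r = ∫⁻ x, f x ∂gammaMeasure a 1 := by
  rw [lintegral_gammaMeasure (by fun_prop), lintegral_gammaMeasure hf]
  conv_rhs => rw [lintegral_Ioi_comp_mul_left hr,
    ← lintegral_const_mul' _ _ ENNReal.ofReal_ne_top]
  refine setLIntegral_congr_fun measurableSet_Ioi fun x hx => ?_
  have hx : 0 < x := hx
  rw [← mul_assoc, ← ENNReal.ofReal_mul hr.le, Real.mul_rpow hr.le hx.le, Real.one_rpow, one_mul,
    Real.rpow_sub_one hr.ne']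
  congr 2
  field_simp

/-- The law of the ratio of independent gamma variables of shapes `a` and `b` and equal scales. -/
noncomputable def betaPrime (a b : ℝ) : Measure ℝ :=
  (volume.restrict (Set.Ioi 0)).withDensity fun v =>
    ENNReal.ofReal (v ^ (a - 1) * (1 + v) ^ (-(a + b)) / beta a b)

theorem lintegral_betaPrime {a b : ℝ} {f : ℝ → ℝ≥0∞} (hf : Measurable f) :
    ∫⁻ v, f v ∂betaPrime a b = ∫⁻ v in Set.Ioi (0 : ℝ),
      ENNReal.ofReal (v ^ (a - 1) * (1 + v) ^ (-(a + b)) / beta a b) * f v := by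
  rw [betaPrime, lintegral_withDensity_eq_lintegral_mul _ (by fun_prop) hf]
  rfl

theorem lintegral_rpow_mul_exp_neg {a r : ℝ} (ha : 0 < a) (hr : 0 < r) :
    ∫⁻ x in Set.Ioi (0 : ℝ), ENNReal.ofReal (x ^ (a - 1) * Real.exp (-(r * x))) =
      ENNReal.ofReal (Real.Gamma a * r ^ (-a)) := by
  have := isProbabilityMeasure_gammaMeasure ha hr
  have h : ∫⁻ _, 1 ∂gammaMeasure a r = 1 := by simp
  rw [lintegral_gammaMeasure measurable_const] at h
  have e : ∀ x : ℝ, ENNReal.ofReal (r ^ a / Real.Gamma a * x ^ (a - 1) * Real.exp (-(r * x))) * 1 =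
      ENNReal.ofReal (r ^ a / Real.Gamma a) * ENNReal.ofReal (x ^ (a - 1) * Real.exp (-(r * x))) :=
    fun x => by rw [mul_one, mul_assoc, ENNReal.ofReal_mul (by positivity)]
  simp_rw [e] at h
  rw [lintegral_const_mul' _ _ ENNReal.ofReal_ne_top] at h
  rw [ENNReal.eq_inv_of_mul_eq_one_left ((mul_comm _ _).trans h),
    ← ENNReal.ofReal_inv_of_pos (by positivity), inv_div, Real.rpow_neg hr.le, div_eq_mul_inv]

/-- Substitute `x = y v` and integrate over `y` first: what remains is a gamma integral of shape `a
+ b` and rate `1 + v`. -/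
theorem lintegral_gamma_ratio {a b : ℝ} (ha : 0 < a) (hb : 0 < b) {f : ℝ → ℝ≥0∞}
    (hf : Measurable f) :
    ∫⁻ y, ∫⁻ x, f (x / y) ∂gammaMeasure a 1 ∂gammaMeasure b 1 = ∫⁻ v, f v ∂betaPrime a b := by
  have := isProbabilityMeasure_gammaMeasure ha one_pos
  have hm : Measurable fun y => ∫⁻ x, f (x / y) ∂gammaMeasure a 1 :=
    Measurable.lintegral_prod_right' (f := fun p : ℝ × ℝ => f (p.2 / p.1)) (by fun_prop)
  rw [lintegral_gammaMeasure hm, lintegral_betaPrime hf]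
  have e1 : ∀ y ∈ Set.Ioi (0 : ℝ), ENNReal.ofReal
      (1 ^ b / Real.Gamma b * y ^ (b - 1) * Real.exp (-(1 * y))) *
        ∫⁻ x, f (x / y) ∂gammaMeasure a 1 =
      ∫⁻ v in Set.Ioi (0 : ℝ), ENNReal.ofReal (v ^ (a - 1) / (Real.Gamma a * Real.Gamma b)) * f v *
        ENNReal.ofReal (y ^ (a + b - 1) * Real.exp (-((1 + v) * y))) := by
    intro y hy
    have hy : 0 < y := hy
    rw [lintegral_gammaMeasure (by fun_prop), lintegral_Ioi_comp_mul_left hy,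
      ← lintegral_const_mul' _ _ ENNReal.ofReal_ne_top,
      ← lintegral_const_mul' _ _ ENNReal.ofReal_ne_top]
    refine setLIntegral_congr_fun measurableSet_Ioi fun v hv => ?_
    have hv : 0 < v := hv
    rw [mul_div_cancel_left₀ _ hy.ne',
      mul_right_comm (ENNReal.ofReal (v ^ (a - 1) / (Real.Gamma a * Real.Gamma b))),
      ← ENNReal.ofReal_mul (by positivity),
      ← mul_assoc, ← mul_assoc, ← ENNReal.ofReal_mul (by positivity),
      ← ENNReal.ofReal_mul (by positivity)]
    congr 2
    rw [Real.mul_rpow hy.le hv.le, Real.one_rpow, Real.one_rpow, one_mul, one_mul,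
      show -((1 + v) * y) = -y + -(y * v) by ring, Real.exp_add,
      show a + b - 1 = (b - 1) + 1 + (a - 1) by ring, Real.rpow_add hy, Real.rpow_add_one hy.ne']
    field_simp
  rw [setLIntegral_congr_fun measurableSet_Ioi e1, lintegral_lintegral_swap (by fun_prop)]
  refine setLIntegral_congr_fun measurableSet_Ioi fun v hv => ?_
  have hv : 0 < v := hv
  rw [lintegral_const_mul _ (by fun_prop),
    lintegral_rpow_mul_exp_neg (add_pos ha hb) (by positivity), mul_right_comm,
    ← ENNReal.ofReal_mul (by positivity)]
  congr 2
  rw [beta]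
  field_simp

theorem isProbabilityMeasure_betaPrime {a b : ℝ} (ha : 0 < a) (hb : 0 < b) :
    IsProbabilityMeasure (betaPrime a b) := by
  have := isProbabilityMeasure_gammaMeasure ha one_pos
  have := isProbabilityMeasure_gammaMeasure hb one_pos
  have h := lintegral_gamma_ratio ha hb (f := 1) measurable_one
  simp only [Pi.one_apply, lintegral_one, measure_univ] at h
  exact ⟨h.symm⟩

theorem lintegral_gamma_ratio_rate {a b r s : ℝ} (ha : 0 < a) (hb : 0 < b) (hr : 0 < r)
    (hs : 0 < s) {f : ℝ → ℝ≥0∞} (hf : Measurable f) :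
    ∫⁻ y, ∫⁻ x, f (x / y) ∂gammaMeasure a r ∂gammaMeasure b s =
      ∫⁻ v, f (s / r * v) ∂betaPrime a b := by
  have := isProbabilityMeasure_gammaMeasure ha one_pos
  rw [← lintegral_gamma_ratio ha hb (f := fun v => f (s / r * v)) (by fun_prop),
    ← lintegral_gammaMeasure_comp_mul hs]
  · refine lintegral_congr fun y => ?_
    rw [← lintegral_gammaMeasure_comp_mul hr (by fun_prop)]
    refine lintegral_congr fun x => ?_
    congr 1
    field_simp
  · exact Measurable.lintegral_prod_right'
      (f := fun p : ℝ × ℝ => f (s / r * (p.2 / p.1))) (by fun_prop)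

/-! ### The tail of the ratio for integer shape -/

/-- The coefficient of `w ^ k * (1 + w) ^ (-(m + k))` in the tail of the beta prime law. -/
noncomputable def tailCoeff (m : ℝ) (k : ℕ) : ℝ :=
  Real.Gamma (m + k) / (Real.Gamma m * k.factorial)

theorem tailCoeff_pos {m : ℝ} (hm : 0 < m) (k : ℕ) : 0 < tailCoeff m k := by
  unfold tailCoeff
  positivity

theorem succ_mul_tailCoeff_succ {m : ℝ} (hm : 0 < m) (k : ℕ) :
    (k + 1 : ℝ) * tailCoeff m (k + 1) = (m + k) * tailCoeff m k := by
  unfold tailCoeff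
  rw [Nat.cast_succ, ← add_assoc, Real.Gamma_add_one (by positivity), Nat.factorial_succ]
  push_cast
  field_simp

theorem add_mul_tailCoeff {m : ℝ} (hm : 0 < m) (k : ℕ) :
    (m + k) * tailCoeff m k = 1 / beta (k + 1 : ℕ) m := by
  unfold tailCoeff beta
  rw [show ((k + 1 : ℕ) : ℝ) + m = m + k + 1 by push_cast; ring,
    Real.Gamma_add_one (by positivity), Nat.cast_succ, Real.Gamma_nat_eq_factorial]
  field_simp

/-- The derivatives telescope by the recursion `succ_mul_tailCoeff_succ`; the surviving term is
minus the beta prime density of shapes `n + 1` and `m`. -/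
theorem hasDerivAt_tail_sum {m : ℝ} (hm : 0 < m) (n : ℕ) {w : ℝ} (hw : 0 ≤ w) :
    HasDerivAt (fun w : ℝ => ∑ k ∈ Finset.range (n + 1),
        tailCoeff m k * (w ^ k * (1 + w) ^ (-(m + k))))
      (-((m + n) * tailCoeff m n * (w ^ n * (1 + w) ^ (-(m + n) - 1)))) w := by
  have h1 : 0 < 1 + w := by linarith
  have hd : ∀ k : ℕ, HasDerivAt (fun w : ℝ => (1 + w) ^ (-(m + k)))
      (-(m + k) * (1 + w) ^ (-(m + k) - 1)) w := fun k => by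
    have := ((hasDerivAt_id w).const_add 1).rpow_const (p := -(m + k)) (Or.inl h1.ne')
    simpa using this
  induction n with
  | zero =>
    have := (hd 0).const_mul (tailCoeff m 0)
    simp only [zero_add, Finset.range_one, Finset.sum_singleton, pow_zero, one_mul] at this ⊢
    convert! this using 1
    ring
  | succ n ih =>
    have h2 := ((hasDerivAt_pow (n + 1) w).mul (hd (n + 1))).const_mul (tailCoeff m (n + 1))
    simp_rw [Finset.sum_range_succ _ (n + 1)]
    convert! ih.add h2 using 1
    have h3 := succ_mul_tailCoeff_succ hm n
    have h4 : (1 + w) ^ (-(m + n) - 1) = (1 + w) ^ (-(m + (n + 1 : ℕ))) := by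
      congr 1
      push_cast
      ring
    rw [h4, ← h3]
    rw [add_tsub_cancel_right]
    push_cast
    ring

theorem tendsto_tail_sum {m : ℝ} (hm : 0 < m) (n : ℕ) :
    Tendsto (fun w : ℝ => ∑ k ∈ Finset.range n,
        tailCoeff m k * (w ^ k * (1 + w) ^ (-(m + k)))) atTop (𝓝 0) := by
  rw [← Finset.sum_const_zero (s := Finset.range n)]
  refine tendsto_finsetSum _ fun k _ => ?_
  rw [← mul_zero (tailCoeff m k)]
  refine Tendsto.const_mul _ ?_
  have h0 : Tendsto (fun w : ℝ => (1 + w) ^ (-m)) atTop (𝓝 0) :=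
    (tendsto_rpow_neg_atTop hm).comp (tendsto_const_nhds.add_atTop tendsto_id)
  refine squeeze_zero' ?_ ?_ h0
  · filter_upwards [eventually_ge_atTop 0] with w hw
    positivity
  · filter_upwards [eventually_ge_atTop 0] with w hw
    have h1 : 0 < 1 + w := by linarith
    rw [neg_add, Real.rpow_add h1, Real.rpow_neg h1.le k, Real.rpow_natCast, mul_left_comm]
    refine mul_le_of_le_one_right (by positivity) ?_
    rw [← div_eq_mul_inv, div_le_one (by positivity)]
    exact pow_le_pow_left₀ hw (by linarith) k

/-- Integrality of the first shape enters here: minus the density has an explicit finite sum as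
antiderivative, and this sum vanishes at infinity. -/
theorem betaPrime_Ioi {m : ℝ} (hm : 0 < m) {D : ℕ} (hD : 1 ≤ D) {w : ℝ} (hw : 0 ≤ w) :
    betaPrime D m (Set.Ioi w) = ENNReal.ofReal (∑ k ∈ Finset.range D,
      tailCoeff m k * (w ^ k * (1 + w) ^ (-(m + k)))) := by
  obtain ⟨n, rfl⟩ : ∃ n, D = n + 1 := ⟨D - 1, by omega⟩
  have hpos : ∀ x ∈ Set.Ioi w, 0 ≤
      (m + n) * tailCoeff m n * (x ^ n * (1 + x) ^ (-(m + n) - 1)) := fun x hx => by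
    have : 0 < x := hw.trans_lt hx
    have := tailCoeff_pos hm n
    positivity
  have hcont : ContinuousWithinAt (fun w : ℝ => ∑ k ∈ Finset.range (n + 1),
      tailCoeff m k * (w ^ k * (1 + w) ^ (-(m + k)))) (Set.Ici w) w :=
    (hasDerivAt_tail_sum hm n hw).continuousAt.continuousWithinAt
  have hderiv := fun x (hx : x ∈ Set.Ioi w) =>
    hasDerivAt_tail_sum hm n (hw.trans (le_of_lt hx))
  have hneg : ∀ x ∈ Set.Ioi w,
      -((m + n) * tailCoeff m n * (x ^ n * (1 + x) ^ (-(m + n) - 1))) ≤ 0 :=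
    fun x hx => neg_nonpos.2 (hpos x hx)
  have hI := integral_Ioi_of_hasDerivAt_of_nonpos hcont hderiv hneg (tendsto_tail_sum hm _)
  have hInt := integrableOn_Ioi_deriv_of_nonpos hcont hderiv hneg (tendsto_tail_sum hm _)
  rw [integral_neg, zero_sub, neg_inj] at hI
  rw [← hI, ofReal_integral_eq_lintegral_ofReal]
  · rw [betaPrime, withDensity_apply _ measurableSet_Ioi, Measure.restrict_restrict
      measurableSet_Ioi, Set.inter_eq_left.2 (Set.Ioi_subset_Ioi hw)]
    refine setLIntegral_congr_fun measurableSet_Ioi fun x hx => ?_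
    rw [add_mul_tailCoeff hm]
    congr 1
    rw [show ((n + 1 : ℕ) : ℝ) - 1 = n by push_cast; ring, Real.rpow_natCast,
      show -(((n + 1 : ℕ) : ℝ) + m) = -(m + n) - 1 by push_cast; ring]
    ring
  · exact Integrable.congr (Integrable.neg hInt) (ae_of_all _ fun x => neg_neg _)
  · exact (ae_restrict_iff' measurableSet_Ioi).2 (ae_of_all _ hpos)

/-! ### The negative moment of the sum of two ratios -/

theorem ae_betaPrime_pos (a b : ℝ) : ∀ᵐ v ∂betaPrime a b, 0 < v :=
  (withDensity_absolutelyContinuous _ _).ae_le (ae_restrict_mem measurableSet_Ioi)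

/-- Layer cake: `v^(-δ) - (v + w)^(-δ)` is the integral of `δ (v + t)^(-δ - 1)` over `0 < t < w`, so
its mean is that function integrated against the tail. The additive form avoids subtraction in `[0,
∞]`. -/
theorem lintegral_add_rpow_neg {m δ v : ℝ} (hm : 0 < m) {D : ℕ} (hD : 1 ≤ D) (hδ : 0 < δ)
    (hv : 0 < v) :
    ∫⁻ w, ENNReal.ofReal ((v + w) ^ (-δ)) ∂betaPrime D m +
      ∑ k ∈ Finset.range D, ENNReal.ofReal (δ * tailCoeff m k) *
        ∫⁻ w in Set.Ioi (0 : ℝ),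
          ENNReal.ofReal ((v + w) ^ (-δ - 1) * (w ^ k * (1 + w) ^ (-(m + k)))) =
      ENNReal.ofReal (v ^ (-δ)) := by
  have hD' : (0 : ℝ) < D := by exact_mod_cast hD
  have := isProbabilityMeasure_betaPrime hD' hm
  have hcont : ∀ t : ℝ, 0 ≤ t → ContinuousOn (fun w : ℝ => δ * (v + w) ^ (-δ - 1))
      (Set.uIcc 0 t) := fun t ht => by
    refine ContinuousOn.mul continuousOn_const
      (ContinuousOn.rpow_const (by fun_prop) fun x hx => ?_)
    rw [Set.uIcc_of_le ht] at hx
    exact Or.inl (by linarith [hx.1])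
  have hFTC : ∀ t : ℝ, 0 ≤ t → ∫ w in (0 : ℝ)..t, δ * (v + w) ^ (-δ - 1) =
      v ^ (-δ) - (v + t) ^ (-δ) := fun t ht => by
    rw [intervalIntegral.integral_eq_sub_of_hasDerivAt (f := fun w => -(v + w) ^ (-δ))]
    · simp only [add_zero]
      ring
    · intro x hx
      rw [Set.uIcc_of_le ht] at hx
      have h1 : 0 < v + x := by linarith [hx.1]
      have := (((hasDerivAt_id x).const_add v).rpow_const (p := -δ) (Or.inl h1.ne')).neg
      convert! this using 1
      simp
    · exact (hcont t ht).intervalIntegrable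
  have hlayer := lintegral_comp_eq_lintegral_meas_lt_mul (betaPrime D m) (f := id)
    (g := fun w => δ * (v + w) ^ (-δ - 1)) ((ae_betaPrime_pos D m).mono fun _ h => h.le)
    aemeasurable_id (fun t ht => (hcont t (le_of_lt ht)).intervalIntegrable)
    ((ae_restrict_iff' measurableSet_Ioi).2 (ae_of_all _ fun w hw => by
      have : 0 < w := hw
      positivity))
  have hsum : ∑ k ∈ Finset.range D, ENNReal.ofReal (δ * tailCoeff m k) *
        ∫⁻ w in Set.Ioi (0 : ℝ),
          ENNReal.ofReal ((v + w) ^ (-δ - 1) * (w ^ k * (1 + w) ^ (-(m + k)))) =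
      ∫⁻ w, ENNReal.ofReal (v ^ (-δ) - (v + w) ^ (-δ)) ∂betaPrime D m := by
    rw [← lintegral_congr_ae ((ae_betaPrime_pos D m).mono fun w hw =>
      congrArg ENNReal.ofReal (hFTC w hw.le))]
    simp only [id] at hlayer
    rw [hlayer]
    simp_rw [← lintegral_const_mul' _ _ (ENNReal.ofReal_ne_top (r := _))]
    rw [← lintegral_finsetSum _ (fun k _ => by fun_prop)]
    refine setLIntegral_congr_fun measurableSet_Ioi fun w hw => ?_
    have hw : 0 < w := hw
    have hset : {a : ℝ | w < a} = Set.Ioi w := rfl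
    rw [hset, betaPrime_Ioi hm hD hw.le, mul_comm, ← ENNReal.ofReal_mul (by positivity),
      Finset.mul_sum, ENNReal.ofReal_sum_of_nonneg]
    · refine Finset.sum_congr rfl fun k _ => ?_
      have := tailCoeff_pos hm k
      rw [← ENNReal.ofReal_mul (by positivity)]
      congr 1
      ring
    · intro k _
      have := tailCoeff_pos hm k
      positivity
  rw [hsum, ← lintegral_add_left (by fun_prop)]
  have : ∀ᵐ w ∂betaPrime D m, ENNReal.ofReal ((v + w) ^ (-δ)) +
      ENNReal.ofReal (v ^ (-δ) - (v + w) ^ (-δ)) = ENNReal.ofReal (v ^ (-δ)) :=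
    (ae_betaPrime_pos D m).mono fun w hw => by
      have : (v + w) ^ (-δ) ≤ v ^ (-δ) :=
        Real.rpow_le_rpow_of_nonpos hv (by linarith) (by linarith)
      rw [← ENNReal.ofReal_add (by positivity) (by linarith), add_sub_cancel]
  rw [lintegral_congr_ae this]
  simp

/-- Multiplying the density by `v^(-δ)` gives a multiple of the beta prime density of shapes `a - δ`
and `m + δ`. -/
theorem lintegral_betaPrime_rpow_neg {a m δ : ℝ} (hm : 0 < m) (hδ : 0 < δ) (ha : δ < a) :
    ∫⁻ v, ENNReal.ofReal (v ^ (-δ)) ∂betaPrime a m =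
      ENNReal.ofReal (beta (a - δ) (m + δ) / beta a m) := by
  have hB := beta_pos (hδ.trans ha) hm
  have hB' := beta_pos (sub_pos.2 ha) (add_pos hm hδ)
  have := isProbabilityMeasure_betaPrime (sub_pos.2 ha) (add_pos hm hδ)
  have h : ∫⁻ _, 1 ∂betaPrime (a - δ) (m + δ) = 1 := by simp
  rw [lintegral_betaPrime measurable_const] at h
  rw [← mul_one (ENNReal.ofReal _), ← h, lintegral_betaPrime (by fun_prop),
    ← lintegral_const_mul' _ _ ENNReal.ofReal_ne_top]
  refine setLIntegral_congr_fun measurableSet_Ioi fun v hv => ?_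
  have hv : 0 < v := hv
  rw [mul_one, ← ENNReal.ofReal_mul (by positivity), ← ENNReal.ofReal_mul (by positivity)]
  congr 1
  rw [show a - δ - 1 = a - 1 + -δ by ring, Real.rpow_add hv,
    show a - δ + (m + δ) = a + m by ring]
  field_simp

/-- Coordinates total and proportion, with Jacobian `s`, obtained from one-variable substitutions:
`v = w y / (1 - y)` at fixed `w`, then `w = (1 - y) s` at fixed `y`. -/
theorem lintegral_quadrant {F : ℝ → ℝ → ℝ≥0∞} (hF : Measurable (Function.uncurry F)) :
    ∫⁻ v in Set.Ioi (0 : ℝ), ∫⁻ w in Set.Ioi (0 : ℝ), F v w =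
      ∫⁻ y in Set.Ioo (0 : ℝ) 1, ∫⁻ s in Set.Ioi (0 : ℝ),
        ENNReal.ofReal s * F (s * y) (s * (1 - y)) := by
  have hF' : Measurable fun p : ℝ × ℝ => F p.1 p.2 := hF
  rw [lintegral_lintegral_swap hF'.aemeasurable]
  have e1 : ∀ w ∈ Set.Ioi (0 : ℝ), ∫⁻ v in Set.Ioi (0 : ℝ), F v w =
      ∫⁻ y in Set.Ioo (0 : ℝ) 1, ENNReal.ofReal w *
        (ENNReal.ofReal (1 / (1 - y) ^ 2) * F (w * (y / (1 - y))) w) := fun w hw => by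
    rw [lintegral_Ioi_comp_mul_left hw, lintegral_Ioi_eq_lintegral_Ioo,
      lintegral_const_mul' _ _ ENNReal.ofReal_ne_top]
  rw [setLIntegral_congr_fun measurableSet_Ioi e1, lintegral_lintegral_swap]
  · refine setLIntegral_congr_fun measurableSet_Ioo fun y hy => ?_
    have h1 : 0 < 1 - y := by linarith [hy.2]
    rw [lintegral_Ioi_comp_mul_left h1, ← lintegral_const_mul' _ _ ENNReal.ofReal_ne_top]
    refine setLIntegral_congr_fun measurableSet_Ioi fun s hs => ?_
    have hs : 0 < s := hs
    rw [← mul_assoc, ← mul_assoc, ← ENNReal.ofReal_mul (by positivity),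
      ← ENNReal.ofReal_mul (by positivity)]
    have a1 : (1 - y) * ((1 - y) * s) * (1 / (1 - y) ^ 2) = s := by field_simp
    have a2 : (1 - y) * s * (y / (1 - y)) = s * y := by field_simp
    rw [a1, a2, mul_comm (1 - y) s]
  · have : Measurable fun p : ℝ × ℝ => F (p.1 * (p.2 / (1 - p.2))) p.1 :=
      hF'.comp (by fun_prop : Measurable fun p : ℝ × ℝ => (p.1 * (p.2 / (1 - p.2)), p.1))
    exact Measurable.aemeasurable (by fun_prop)

/-! ### The coefficients `C_k` -/

section Coefficients

variable {α mI : ℝ} {mD k : ℕ}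

/-- At fixed `u` the powers of `s` collect into exponent `-(2/α) + m_D + k - 1`, and
`setLIntegral_eq_gaussHyp` applies with `y = u`, `z = 1 - u`. The denominator of the beta factor is
the `Γ(c)` that regularizes `₂F₁`. -/
theorem setLIntegral_eq_coeffIntegrand (hα : 2 < α) (hmI : 0 < mI) (hmD : 1 ≤ mD) {u : ℝ}
    (hu : u ∈ Set.Ioo (0 : ℝ) 1) :
    ∫⁻ s in Set.Ioi (0 : ℝ), ENNReal.ofReal s * ENNReal.ofReal
      ((s * u + s * (1 - u)) ^ (-(2 / α) - 1) *
        (((s * u) ^ ((mD : ℝ) - 1) * (1 + s * u) ^ (-(mD + mI))) *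
          ((s * (1 - u)) ^ k * (1 + s * (1 - u)) ^ (-(mI + k))))) =
      ENNReal.ofReal (Real.Gamma (-(2 / α) + mD + k) * Real.Gamma (2 * mI + 2 / α) *
        coeffIntegrand α mI mD k u) := by
  have hδ1 : 2 / α < 1 := by rw [div_lt_one (by linarith)]; exact hα
  have hδ0 : 0 < 2 / α := by positivity
  have hD : (1 : ℝ) ≤ mD := by exact_mod_cast hmD
  have h0 := hu.1
  have h1 : 0 < 1 - u := by linarith [hu.2]
  have ha : 0 < -(2 / α) + mD + k := by linarith
  have hE := setLIntegral_eq_gaussHyp (p := mD + mI) (q := mI + k) ha (by positivity)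
    (by positivity) (by linarith) h0 h1
  have e1 : (mD + mI + (mI + k) : ℝ) = 2 * mI + mD + k := by ring
  have e2 : 1 - (1 - u) / u = (2 * u - 1) / u := by
    field_simp
    ring
  have e3 : 2 * mI + mD + k - (-(2 / α) + mD + k) = 2 * mI + 2 / α := by ring
  rw [e1, e2, e3] at hE
  have e4 : Real.Gamma (-(2 / α) + mD + k) * Real.Gamma (2 * mI + 2 / α) *
      coeffIntegrand α mI mD k u = u ^ ((mD : ℝ) - 1) * (1 - u) ^ k *
        (u ^ (-(-(2 / α) + mD + k)) * (beta (-(2 / α) + mD + k) (2 * mI + 2 / α) *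
          gaussHyp (-(2 / α) + mD + k) (mI + k) (2 * mI + mD + k) ((2 * u - 1) / u))) := by
    rw [coeffIntegrand, regGaussHyp, beta,
      show 2 / α - 1 - (k : ℝ) = (mD - 1) + (-(-(2 / α) + mD + k)) by ring, Real.rpow_add h0,
      show -(2 / α) + mD + k + (2 * mI + 2 / α) = 2 * mI + mD + k by ring]
    field_simp
  rw [e4, ENNReal.ofReal_mul (by positivity), ← hE,
    ← lintegral_const_mul' _ _ ENNReal.ofReal_ne_top]
  refine setLIntegral_congr_fun measurableSet_Ioi fun s hs => ?_
  have hs : 0 < s := hs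
  rw [← ENNReal.ofReal_mul hs.le, ← ENNReal.ofReal_mul (by positivity)]
  congr 1
  rw [show s * u + s * (1 - u) = s by ring, Real.mul_rpow hs.le h0.le, mul_pow,
    show -(2 / α) + mD + k - 1 = (-(2 / α) - 1) + (mD - 1) + 1 + k by ring,
    Real.rpow_add_natCast hs.ne', Real.rpow_add_one hs.ne', Real.rpow_add hs]
  ring

/-- The sign is read off the integral representation: a negative value would force the integral of a
strictly positive function to vanish. -/
theorem coeffIntegrand_nonneg (hα : 2 < α) (hmI : 0 < mI) (hmD : 1 ≤ mD) {u : ℝ}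
    (hu : u ∈ Set.Ioo (0 : ℝ) 1) : 0 ≤ coeffIntegrand α mI mD k u := by
  have hδ1 : 2 / α < 1 := by rw [div_lt_one (by linarith)]; exact hα
  have hD : (1 : ℝ) ≤ mD := by exact_mod_cast hmD
  have h0 := hu.1
  have h1 : 0 < 1 - u := by linarith [hu.2]
  have hG1 := Real.Gamma_pos_of_pos (show 0 < -(2 / α) + mD + k by linarith)
  by_contra hneg
  have h := setLIntegral_eq_coeffIntegrand (k := k) hα hmI hmD hu
  rw [ENNReal.ofReal_of_nonpos (mul_nonpos_of_nonneg_of_nonpos (by positivity)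
    (not_le.1 hneg).le), lintegral_eq_zero_iff (by fun_prop)] at h
  have hne : ∀ᵐ s ∂volume.restrict (Set.Ioi (0 : ℝ)), False := by
    filter_upwards [h, ae_restrict_mem measurableSet_Ioi] with s hs hs0
    have hs0 : 0 < s := hs0
    rw [Pi.zero_apply, ← ENNReal.ofReal_mul hs0.le, ENNReal.ofReal_eq_zero] at hs
    exact absurd hs (not_le.2 (by positivity))
  have : (ae (volume.restrict (Set.Ioi (0 : ℝ)))).NeBot := by
    rw [ae_neBot, Ne, Measure.restrict_eq_zero]
    simp
  exact hne.exists.elim fun _ h => h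

theorem aestronglyMeasurable_coeffIntegrand (hα : 2 < α) (hmI : 0 < mI) (hmD : 1 ≤ mD) :
    AEStronglyMeasurable (coeffIntegrand α mI mD k) (volume.restrict (Set.Ioo 0 1)) := by
  have hδ1 : 2 / α < 1 := by rw [div_lt_one (by linarith)]; exact hα
  have hD : (1 : ℝ) ≤ mD := by exact_mod_cast hmD
  have hG1 := Real.Gamma_pos_of_pos (show 0 < -(2 / α) + mD + k by linarith)
  have hm : Measurable fun u : ℝ => ∫⁻ s in Set.Ioi (0 : ℝ), ENNReal.ofReal s * ENNReal.ofReal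
      ((s * u + s * (1 - u)) ^ (-(2 / α) - 1) *
        (((s * u) ^ ((mD : ℝ) - 1) * (1 + s * u) ^ (-(mD + mI))) *
          ((s * (1 - u)) ^ k * (1 + s * (1 - u)) ^ (-(mI + k))))) :=
    Measurable.lintegral_prod_right' (f := fun p : ℝ × ℝ => ENNReal.ofReal p.2 * ENNReal.ofReal
      ((p.2 * p.1 + p.2 * (1 - p.1)) ^ (-(2 / α) - 1) *
        (((p.2 * p.1) ^ ((mD : ℝ) - 1) * (1 + p.2 * p.1) ^ (-(mD + mI))) *
          ((p.2 * (1 - p.1)) ^ k * (1 + p.2 * (1 - p.1)) ^ (-(mI + k)))))) (by fun_prop)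
  refine ((hm.ennreal_toReal.const_mul
    (Real.Gamma (-(2 / α) + mD + k) * Real.Gamma (2 * mI + 2 / α))⁻¹).aestronglyMeasurable).congr
    ((ae_restrict_iff' measurableSet_Ioo).2 (ae_of_all _ fun u hu => ?_))
  have := coeffIntegrand_nonneg (k := k) hα hmI hmD hu
  simp only
  rw [setLIntegral_eq_coeffIntegrand hα hmI hmD hu, ENNReal.toReal_ofReal (by positivity),
    inv_mul_cancel_left₀ (by positivity)]

theorem lintegral_lintegral_eq_coeffIntegrand (hα : 2 < α) (hmI : 0 < mI) (hmD : 1 ≤ mD) :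
    ∫⁻ v in Set.Ioi (0 : ℝ), ∫⁻ w in Set.Ioi (0 : ℝ), ENNReal.ofReal
      ((v + w) ^ (-(2 / α) - 1) * ((v ^ ((mD : ℝ) - 1) * (1 + v) ^ (-(mD + mI))) *
          (w ^ k * (1 + w) ^ (-(mI + k))))) =
      ENNReal.ofReal (Real.Gamma (-(2 / α) + mD + k) * Real.Gamma (2 * mI + 2 / α)) *
        ∫⁻ u in Set.Ioo (0 : ℝ) 1, ENNReal.ofReal (coeffIntegrand α mI mD k u) := by
  have hδ1 : 2 / α < 1 := by rw [div_lt_one (by linarith)]; exact hα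
  have hD : (1 : ℝ) ≤ mD := by exact_mod_cast hmD
  have hG1 := Real.Gamma_pos_of_pos (show 0 < -(2 / α) + mD + k by linarith)
  rw [lintegral_quadrant (by unfold Function.uncurry; fun_prop),
    ← lintegral_const_mul' _ _ ENNReal.ofReal_ne_top]
  refine setLIntegral_congr_fun measurableSet_Ioo fun u hu => ?_
  rw [setLIntegral_eq_coeffIntegrand hα hmI hmD hu, ENNReal.ofReal_mul (by positivity)]

/-- The negative moment of the sum of two ratios in terms of the integrals `C_k`. -/
theorem lintegral_sum_ratio_rpow_neg (hα : 2 < α) (hmI : 0 < mI) (hmD : 1 ≤ mD) :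
    ∫⁻ v, ∫⁻ w, ENNReal.ofReal ((v + w) ^ (-(2 / α))) ∂betaPrime mD mI ∂betaPrime mD mI +
      ∑ k ∈ Finset.range mD, ENNReal.ofReal (2 / α * tailCoeff mI k / beta mD mI *
          (Real.Gamma (-(2 / α) + mD + k) * Real.Gamma (2 * mI + 2 / α))) *
        ∫⁻ u in Set.Ioo (0 : ℝ) 1, ENNReal.ofReal (coeffIntegrand α mI mD k u) =
      ENNReal.ofReal (beta (mD - 2 / α) (mI + 2 / α) / beta mD mI) := by
  have hδ1 : 2 / α < 1 := by rw [div_lt_one (by linarith)]; exact hα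
  have hδ0 : 0 < 2 / α := by positivity
  have hD : (1 : ℝ) ≤ mD := by exact_mod_cast hmD
  have hB := beta_pos (show (0 : ℝ) < mD by linarith) hmI
  have := isProbabilityMeasure_betaPrime (show (0 : ℝ) < mD by linarith) hmI
  rw [← lintegral_betaPrime_rpow_neg hmI hδ0 (hδ1.trans_le hD),
    ← lintegral_congr_ae ((ae_betaPrime_pos mD mI).mono
      fun v hv => lintegral_add_rpow_neg (v := v) hmI hmD hδ0 hv),
    lintegral_add_left]
  swap
  · exact Measurable.lintegral_prod_right'
      (f := fun p : ℝ × ℝ => ENNReal.ofReal ((p.1 + p.2) ^ (-(2 / α)))) (by fun_prop)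
  congr 1
  have hmeas : ∀ k : ℕ, Measurable fun v : ℝ => ∫⁻ w in Set.Ioi (0 : ℝ),
      ENNReal.ofReal ((v + w) ^ (-(2 / α) - 1) * (w ^ k * (1 + w) ^ (-(mI + k)))) := fun k =>
    Measurable.lintegral_prod_right' (f := fun p : ℝ × ℝ => ENNReal.ofReal
      ((p.1 + p.2) ^ (-(2 / α) - 1) * (p.2 ^ k * (1 + p.2) ^ (-(mI + k))))) (by fun_prop)
  rw [lintegral_finsetSum _ (fun k _ => (hmeas k).const_mul _)]
  refine Finset.sum_congr rfl fun k _ => ?_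
  have ht := tailCoeff_pos hmI k
  rw [lintegral_const_mul _ (hmeas k), lintegral_betaPrime (hmeas k),
    ENNReal.ofReal_mul (by positivity), mul_assoc,
    ← lintegral_lintegral_eq_coeffIntegrand hα hmI hmD,
    ← lintegral_const_mul' _ _ ENNReal.ofReal_ne_top,
    ← lintegral_const_mul' _ _ ENNReal.ofReal_ne_top]
  refine setLIntegral_congr_fun measurableSet_Ioi fun v hv => ?_
  have hv : 0 < v := hv
  rw [← mul_assoc, ← lintegral_const_mul' _ _ ENNReal.ofReal_ne_top,
    ← ENNReal.ofReal_mul (by positivity), ← lintegral_const_mul' _ _ ENNReal.ofReal_ne_top]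
  refine setLIntegral_congr_fun measurableSet_Ioi fun w hw => ?_
  rw [← ENNReal.ofReal_mul (by positivity), ← ENNReal.ofReal_mul (by positivity)]
  congr 1
  ring

/-- In the moment identity this integral appears with a positive coefficient in a sum bounded by a
finite number, so it cannot be infinite. -/
theorem lintegral_coeffIntegrand_lt_top (hα : 2 < α) (hmI : 0 < mI) (hmD : 1 ≤ mD) (hk : k < mD) :
    ∫⁻ u in Set.Ioo (0 : ℝ) 1, ENNReal.ofReal (coeffIntegrand α mI mD k u) < ∞ := by
  have hδ1 : 2 / α < 1 := by rw [div_lt_one (by linarith)]; exact hα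
  have hD : (1 : ℝ) ≤ mD := by exact_mod_cast hmD
  have hB := beta_pos (show (0 : ℝ) < mD by linarith) hmI
  have hG1 := Real.Gamma_pos_of_pos (show 0 < -(2 / α) + mD + k by linarith)
  have ht := tailCoeff_pos hmI k
  have hfin := (lintegral_sum_ratio_rpow_neg hα hmI hmD).trans_lt ENNReal.ofReal_lt_top
  have h1 := ENNReal.sum_lt_top.1 (lt_of_le_of_lt le_add_self hfin) k (Finset.mem_range.2 hk)
  by_contra h
  rw [not_lt, top_le_iff] at h
  rw [h, ENNReal.mul_top (ENNReal.ofReal_pos.2 (by positivity)).ne'] at h1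
  exact lt_irrefl _ h1

theorem integrableOn_coeffIntegrand (hα : 2 < α) (hmI : 0 < mI) (hmD : 1 ≤ mD) (hk : k < mD) :
    IntegrableOn (coeffIntegrand α mI mD k) (Set.Ioo 0 1) := by
  refine ⟨aestronglyMeasurable_coeffIntegrand hα hmI hmD, ?_⟩
  rw [hasFiniteIntegral_iff_ofReal]
  · exact lintegral_coeffIntegrand_lt_top hα hmI hmD hk
  · exact (ae_restrict_iff' measurableSet_Ioo).2 (ae_of_all _ fun _ hu =>
      coeffIntegrand_nonneg hα hmI hmD hu)

theorem lintegral_coeffIntegrand (hα : 2 < α) (hmI : 0 < mI) (hmD : 1 ≤ mD) (hk : k < mD) :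
    ∫⁻ u in Set.Ioo (0 : ℝ) 1, ENNReal.ofReal (coeffIntegrand α mI mD k u) =
      ENNReal.ofReal (coeffC α mI mD k) :=
  (ofReal_integral_eq_lintegral_ofReal (integrableOn_coeffIntegrand hα hmI hmD hk)
    ((ae_restrict_iff' measurableSet_Ioo).2 (ae_of_all _ fun _ hu =>
      coeffIntegrand_nonneg hα hmI hmD hu))).symm

theorem coeffC_nonneg (hα : 2 < α) (hmI : 0 < mI) (hmD : 1 ≤ mD) : 0 ≤ coeffC α mI mD k :=
  setIntegral_nonneg measurableSet_Ioo fun _ hu => coeffIntegrand_nonneg hα hmI hmD hu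

/-- The closed form of `𝔼[(W₁ + W₂) ^ (-2 / α)]` for independent ratios `W₁`, `W₂`. -/
noncomputable def ratioMoment (α mI : ℝ) (mD : ℕ) : ℝ :=
  Real.Gamma (mD - 2 / α) * Real.Gamma (mI + 2 / α) / (Real.Gamma mI * Real.Gamma mD) -
    2 / α * (Real.Gamma (2 * mI + 2 / α) / beta mI mD) *
      ∑ k ∈ Finset.range mD,
        Real.Gamma (-(2 / α) + mD + k) * coeffC α mI mD k / (beta mI (k + 1) * (mI + k))

theorem lintegral_sum_ratio_eq_ratioMoment (hα : 2 < α) (hmI : 0 < mI) (hmD : 1 ≤ mD) :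
    ∫⁻ v, ∫⁻ w, ENNReal.ofReal ((v + w) ^ (-(2 / α))) ∂betaPrime mD mI ∂betaPrime mD mI =
      ENNReal.ofReal (ratioMoment α mI mD) := by
  have hδ1 : 2 / α < 1 := by rw [div_lt_one (by linarith)]; exact hα
  have hδ0 : 0 < 2 / α := by positivity
  have hD : (1 : ℝ) ≤ mD := by exact_mod_cast hmD
  have hB := beta_pos (show (0 : ℝ) < mD by linarith) hmI
  have h := lintegral_sum_ratio_rpow_neg hα hmI hmD
  have hterm : ∀ k ∈ Finset.range mD, 0 ≤ 2 / α * tailCoeff mI k / beta mD mI *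
      (Real.Gamma (-(2 / α) + mD + k) * Real.Gamma (2 * mI + 2 / α)) * coeffC α mI mD k :=
    fun k _ => by
      have hk0 : (0 : ℝ) ≤ k := k.cast_nonneg
      have hG1 := Real.Gamma_pos_of_pos (show 0 < -(2 / α) + mD + k by linarith)
      have ht := tailCoeff_pos hmI k
      have := coeffC_nonneg (k := k) hα hmI hmD
      positivity
  have hsum : ∑ k ∈ Finset.range mD, ENNReal.ofReal (2 / α * tailCoeff mI k / beta mD mI *
          (Real.Gamma (-(2 / α) + mD + k) * Real.Gamma (2 * mI + 2 / α))) *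
        ∫⁻ u in Set.Ioo (0 : ℝ) 1, ENNReal.ofReal (coeffIntegrand α mI mD k u) =
      ENNReal.ofReal (∑ k ∈ Finset.range mD, 2 / α * tailCoeff mI k / beta mD mI *
        (Real.Gamma (-(2 / α) + mD + k) * Real.Gamma (2 * mI + 2 / α)) * coeffC α mI mD k) := by
    rw [ENNReal.ofReal_sum_of_nonneg hterm]
    refine Finset.sum_congr rfl fun k hk => ?_
    have hk0 : (0 : ℝ) ≤ k := k.cast_nonneg
    have hG1 := Real.Gamma_pos_of_pos (show 0 < -(2 / α) + mD + k by linarith)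
    have ht := tailCoeff_pos hmI k
    rw [lintegral_coeffIntegrand hα hmI hmD (Finset.mem_range.1 hk), ← ENNReal.ofReal_mul
      (by positivity)]
  rw [hsum] at h
  rw [ENNReal.eq_sub_of_add_eq ENNReal.ofReal_ne_top h,
    ← ENNReal.ofReal_sub _ (Finset.sum_nonneg hterm)]
  congr 1
  unfold ratioMoment
  congr 1
  · unfold beta
    rw [show (mD : ℝ) - 2 / α + (mI + 2 / α) = mD + mI by ring]
    field_simp
  · rw [Finset.mul_sum]
    refine Finset.sum_congr rfl fun k _ => ?_
    -- The factor `1 / (B(m_I, k + 1) (m_I + k))` of the closed form is the tail coefficient.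
    rw [show beta mD mI = beta mI mD by rw [beta, beta, mul_comm, add_comm (mD : ℝ)],
      show beta mI (k + 1) * (mI + k) = (tailCoeff mI k)⁻¹ by
        rw [beta, tailCoeff, ← add_assoc, Real.Gamma_nat_eq_factorial,
          Real.Gamma_add_one (by positivity)]
        field_simp]
    simp only [div_eq_mul_inv, inv_inv]
    ring

/-- The closed form is a difference of nonnegative terms, so positivity is taken from the moment it
represents. -/
theorem ratioMoment_pos (hα : 2 < α) (hmI : 0 < mI) (hmD : 1 ≤ mD) :
    0 < ratioMoment α mI mD := by
  have hD : (0 : ℝ) < mD := by exact_mod_cast hmD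
  have := isProbabilityMeasure_betaPrime hD hmI
  rw [← ENNReal.ofReal_pos, ← lintegral_sum_ratio_eq_ratioMoment hα hmI hmD, pos_iff_ne_zero]
  have hm : Measurable fun v : ℝ => ∫⁻ w, ENNReal.ofReal ((v + w) ^ (-(2 / α))) ∂betaPrime mD mI :=
    Measurable.lintegral_prod_right'
      (f := fun p : ℝ × ℝ => ENNReal.ofReal ((p.1 + p.2) ^ (-(2 / α)))) (by fun_prop)
  intro h
  rw [lintegral_eq_zero_iff hm] at h
  obtain ⟨v, hv, hv0⟩ := (h.and (ae_betaPrime_pos mD mI)).exists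
  rw [Pi.zero_apply, lintegral_eq_zero_iff (by fun_prop)] at hv
  obtain ⟨w, hw, hw0⟩ := (hv.and (ae_betaPrime_pos mD mI)).exists
  rw [Pi.zero_apply, ENNReal.ofReal_eq_zero] at hw
  exact absurd hw (not_le.2 (by positivity))

end Coefficients

/-! ### The exponential `exp (-s)` on `[0, ∞]` -/

/-- `exp (-s)` for `s ∈ [0, ∞]`. -/
noncomputable def expNeg (s : ℝ≥0∞) : ℝ := (EReal.exp (-(s : EReal))).toReal

@[simp] theorem expNeg_top : expNeg ∞ = 0 := by simp [expNeg]

@[simp] theorem expNeg_coe (r : ℝ≥0) : expNeg r = Real.exp (-r) := by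
  have : (-((r : ℝ≥0∞) : EReal)) = ((-(r : ℝ) : ℝ) : EReal) := by
    rw [EReal.coe_neg]
    rfl
  rw [expNeg, this, EReal.exp_coe, ENNReal.toReal_ofReal (Real.exp_nonneg _)]

@[simp] theorem expNeg_zero : expNeg 0 = 1 := by simp [expNeg]

theorem expNeg_nonneg (s : ℝ≥0∞) : 0 ≤ expNeg s := ENNReal.toReal_nonneg

theorem expNeg_ofReal {x : ℝ} (hx : 0 ≤ x) : expNeg (ENNReal.ofReal x) = Real.exp (-x) := by
  rw [ENNReal.ofReal, expNeg_coe, Real.coe_toNNReal _ hx]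

theorem expNeg_add (s t : ℝ≥0∞) : expNeg (s + t) = expNeg s * expNeg t := by
  induction s using ENNReal.recTopCoe with
  | top => simp
  | coe s =>
    induction t using ENNReal.recTopCoe with
    | top => simp
    | coe t =>
      rw [← ENNReal.coe_add, expNeg_coe, expNeg_coe, expNeg_coe, ← Real.exp_add]
      push_cast
      congr 1
      ring

theorem expNeg_strictAnti : StrictAnti expNeg := by
  intro s t hst
  induction s using ENNReal.recTopCoe with
  | top => simp at hst
  | coe s =>
    induction t using ENNReal.recTopCoe with
    | top => simpa using Real.exp_pos _
    | coe t =>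
      rw [expNeg_coe, expNeg_coe, Real.exp_lt_exp, neg_lt_neg_iff]
      exact_mod_cast hst

theorem expNeg_le_one (s : ℝ≥0∞) : expNeg s ≤ 1 := by
  rw [← expNeg_zero]
  exact expNeg_strictAnti.antitone bot_le

theorem continuous_expNeg : Continuous expNeg := by
  have h : Continuous fun s : ℝ≥0∞ => EReal.exp (-(s : EReal)) :=
    ENNReal.continuous_exp.comp (continuous_neg.comp continuous_coe_ennreal_ereal)
  refine ENNReal.continuousOn_toReal.comp_continuous h fun s => ?_
  simp

@[fun_prop]
theorem measurable_expNeg : Measurable expNeg := continuous_expNeg.measurable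

theorem expNeg_sum {ι : Type*} (s : Finset ι) (f : ι → ℝ≥0∞) :
    expNeg (∑ i ∈ s, f i) = ∏ i ∈ s, expNeg (f i) := by
  classical
  induction s using Finset.induction_on with
  | empty => simp
  | insert i s hi ih => rw [Finset.sum_insert hi, Finset.prod_insert hi, expNeg_add, ih]

theorem expNeg_mul_natCast (c : ℝ≥0∞) (n : ℕ) : expNeg (c * n) = expNeg c ^ n := by
  have := expNeg_sum (Finset.range n) (fun _ => c)
  simpa [mul_comm] using this

theorem norm_expNeg_le_one (s : ℝ≥0∞) : ‖expNeg s‖ ≤ 1 := by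
  rw [Real.norm_of_nonneg (expNeg_nonneg s)]
  exact expNeg_le_one s

theorem integrable_expNeg {Ω : Type*} [MeasurableSpace Ω] {P : Measure Ω} [IsFiniteMeasure P]
    {f : Ω → ℝ≥0∞} (hf : AEMeasurable f P) : Integrable (fun ω => expNeg (f ω)) P :=
  Integrable.of_bound (measurable_expNeg.comp_aemeasurable hf).aestronglyMeasurable 1
    (ae_of_all _ fun _ => norm_expNeg_le_one _)

/-- The inverse of `expNeg`, `-log t` for `t ∈ [0, 1]`. -/
noncomputable def negLog (t : ℝ) : ℝ≥0∞ := if t ≤ 0 then ∞ else ENNReal.ofReal (-Real.log t)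

@[fun_prop]
theorem measurable_negLog : Measurable negLog :=
  Measurable.ite measurableSet_Iic measurable_const (by fun_prop)

theorem expNeg_negLog {t : ℝ} (h0 : 0 ≤ t) (h1 : t ≤ 1) : expNeg (negLog t) = t := by
  unfold negLog
  split_ifs with h
  · rw [expNeg_top, le_antisymm h h0]
  · push Not at h
    rw [expNeg_ofReal (neg_nonneg.2 (Real.log_nonpos h0 h1)), neg_neg, Real.exp_log h]

/-! ### The Laplace functional of a Poisson point process -/

section Laplace

/-- Group the points by the value of `f`. The value `0` contributes nothing and is dropped because
its level set may have infinite intensity. -/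
theorem tsum_simpleFunc_eq_sum_pointCount {Ω E : Type*} [MeasurableSpace E] {x : ℕ → Ω → E}
    (f : SimpleFunc E ℝ≥0∞) (ω : Ω) :
    ∑' i, f (x i ω) = ∑ c ∈ f.range.erase 0, c * (pointCount x (f ⁻¹' {c}) ω : ℝ≥0∞) := by
  have h1 : ∀ i, f (x i ω) =
      ∑ c ∈ f.range.erase 0, Set.indicator {i | x i ω ∈ f ⁻¹' {c}} (fun _ => c) i := fun i => by
    by_cases h0 : f (x i ω) = 0
    · rw [h0, Finset.sum_eq_zero]
      intro c hc
      rw [Set.indicator_of_notMem]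
      simp only [Set.mem_preimage, Set.mem_singleton_iff, Set.mem_ofPred_eq, h0]
      exact (Finset.ne_of_mem_erase hc).symm
    · rw [Finset.sum_eq_single (f (x i ω))]
      · rw [Set.indicator_of_mem]
        simp
      · intro c _ hc
        rw [Set.indicator_of_notMem]
        simpa using hc.symm
      · intro h
        exact absurd (Finset.mem_erase.2 ⟨h0, f.mem_range_self _⟩) h
  simp_rw [h1]
  rw [Summable.tsum_finsetSum (fun _ _ => ENNReal.summable)]
  refine Finset.sum_congr rfl fun c _ => ?_
  rw [← tsum_subtype, ENNReal.tsum_set_const, mul_comm]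
  rfl

variable {Ω : Type*} [MeasurableSpace Ω] {P : Measure Ω}

theorem integral_expNeg_poissonMeasure (c : ℝ≥0∞) (r : ℝ≥0) :
    ∫ n : ℕ, expNeg (c * n) ∂poissonMeasure r = expNeg (ENNReal.ofReal (1 - expNeg c) * r) := by
  rw [integral_poissonMeasure]
  simp_rw [expNeg_mul_natCast, smul_eq_mul]
  have h := (NormedSpace.expSeries_div_hasSum_exp (r * expNeg c : ℝ)).mul_left (Real.exp (-r))
  have e : ∀ n : ℕ, Real.exp (-r) * (r : ℝ) ^ n / n.factorial * expNeg c ^ n =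
      Real.exp (-r) * ((r * expNeg c) ^ n / n.factorial) := fun n => by
    rw [mul_pow]
    ring
  simp_rw [e]
  rw [h.tsum_eq, ← Real.exp_eq_exp_ℝ, ← Real.exp_add, ← ENNReal.ofReal_coe_nnreal,
    ← ENNReal.ofReal_mul (sub_nonneg.2 (expNeg_le_one c)), expNeg_ofReal
      (mul_nonneg (sub_nonneg.2 (expNeg_le_one c)) r.coe_nonneg)]
  congr 1
  ring

variable {E : Type*} [MeasurableSpace E] {x : ℕ → Ω → E} {Λ : Measure E}

theorem integral_expNeg_mul_pointCount (hx : IsPoissonPointProcess P x Λ) (c : ℝ≥0∞) {A : Set E}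
    (hA : MeasurableSet A) (hΛ : Λ A ≠ ∞) :
    ∫ ω, expNeg (c * (pointCount x A ω : ℝ≥0∞)) ∂P =
      expNeg (ENNReal.ofReal (1 - expNeg c) * Λ A) := by
  have hlaw := hx.count_law A hA hΛ
  have hm : Measurable fun n : ℕ∞ => expNeg (c * (n : ℝ≥0∞)) := Measurable.of_discrete
  rw [← integral_map (φ := pointCount x A) (f := fun n : ℕ∞ => expNeg (c * (n : ℝ≥0∞)))
    hlaw.aemeasurable hm.aestronglyMeasurable, hlaw.map_eq,
    integral_map (Measurable.of_discrete).aemeasurable hm.aestronglyMeasurable]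
  simp only [ENat.toENNReal_coe]
  rw [integral_expNeg_poissonMeasure, ENNReal.coe_toNNReal hΛ]

/-- The nonzero level sets are disjoint of finite intensity, so their counts are independent Poisson
variables and the expectation factors. -/
theorem laplace_simpleFunc [IsProbabilityMeasure P] (hx : IsPoissonPointProcess P x Λ)
    (f : SimpleFunc E ℝ≥0∞) (hf : ∀ c ≠ 0, Λ (f ⁻¹' {c}) ≠ ∞) :
    ∫ ω, expNeg (∑' i, f (x i ω)) ∂P = expNeg (∫⁻ y, ENNReal.ofReal (1 - expNeg (f y)) ∂Λ) := by
  set s := f.range.erase 0 with hs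
  let e := s.equivFin
  have hne : ∀ j, ((e.symm j : s) : ℝ≥0∞) ≠ 0 := fun j => Finset.ne_of_mem_erase (e.symm j).2
  have hAm : ∀ j, MeasurableSet (f ⁻¹' {((e.symm j : s) : ℝ≥0∞)}) := fun j =>
    f.measurableSet_preimage _
  have hind := hx.count_indep s.card (fun j => f ⁻¹' {((e.symm j : s) : ℝ≥0∞)}) hAm
    (fun j => hf _ (hne j)) (fun i j hij => by
      refine Set.disjoint_left.2 fun y hy hy' => hij ?_
      simp only [Set.mem_preimage, Set.mem_singleton_iff] at hy hy'
      exact e.symm.injective (Subtype.ext (hy.symm.trans hy')))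
  have h1 : ∀ ω, expNeg (∑' i, f (x i ω)) = ∏ j, expNeg
      ((e.symm j : s) * (pointCount x (f ⁻¹' {((e.symm j : s) : ℝ≥0∞)}) ω : ℝ≥0∞)) := fun ω => by
    rw [tsum_simpleFunc_eq_sum_pointCount, expNeg_sum, ← hs, ← Finset.prod_coe_sort,
      ← Equiv.prod_comp e.symm]
  simp_rw [h1]
  rw [hind.integral_fun_prod_comp
    (f := fun j (n : ℕ∞) => expNeg ((e.symm j : s) * (n : ℝ≥0∞)))
    (fun j => (hx.count_law _ (hAm j) (hf _ (hne j))).aemeasurable)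
    (fun j => (Measurable.of_discrete).aestronglyMeasurable)]
  simp_rw [integral_expNeg_mul_pointCount hx _ (hAm _) (hf _ (hne _))]
  rw [Equiv.prod_comp e.symm (fun c : s => expNeg (ENNReal.ofReal (1 - expNeg c) *
      Λ (f ⁻¹' {(c : ℝ≥0∞)}))), Finset.prod_coe_sort s
      (fun c => expNeg (ENNReal.ofReal (1 - expNeg c) * Λ (f ⁻¹' {c}))), ← expNeg_sum, hs,
    Finset.sum_erase]
  · rw [← SimpleFunc.map_lintegral (fun c => ENNReal.ofReal (1 - expNeg c)),
      ← SimpleFunc.lintegral_eq_lintegral]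
    rfl
  · simp

theorem measurable_tsum_comp {f : E → ℝ≥0∞} (hx : ∀ i, Measurable (x i)) (hf : Measurable f) :
    Measurable fun ω => ∑' i, f (x i ω) :=
  Measurable.tsum fun i => hf.comp (hx i)

/-- The **Laplace functional** of a Poisson point process. -/
theorem laplace_functional [IsProbabilityMeasure P] [SigmaFinite Λ]
    (hx : IsPoissonPointProcess P x Λ) {f : E → ℝ≥0∞} (hf : Measurable f) :
    ∫ ω, expNeg (∑' i, f (x i ω)) ∂P = expNeg (∫⁻ y, ENNReal.ofReal (1 - expNeg (f y)) ∂Λ) := by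
  -- Cutting off to finite-intensity sets exhausting the space makes nonzero level sets finite and
  -- keeps the convergence monotone.
  let F : ℕ → SimpleFunc E ℝ≥0∞ := fun n => (SimpleFunc.eapprox f n).restrict (spanningSets Λ n)
  have hFa : ∀ n y, F n y = (spanningSets Λ n).indicator (SimpleFunc.eapprox f n) y := fun n y =>
    SimpleFunc.restrict_apply _ (measurableSet_spanningSets Λ n) y
  have hmono : ∀ y, Monotone fun n => F n y := fun y n k hnk => by
    simp only [hFa]
    refine (Set.indicator_le_indicator (SimpleFunc.monotone_eapprox f hnk y)).trans ?_
    exact Set.indicator_le_indicator_of_subset (monotone_spanningSets Λ hnk) (fun _ => bot_le) y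
  have htend : ∀ y, Tendsto (fun n => F n y) atTop (𝓝 (f y)) := fun y => by
    refine (SimpleFunc.tendsto_eapprox hf y).congr' ?_
    filter_upwards [eventually_ge_atTop (spanningSetsIndex Λ y)] with n hn
    rw [hFa, Set.indicator_of_mem (mem_spanningSets_of_index_le Λ y hn)]
  have hfin : ∀ n, ∀ c ≠ 0, Λ (F n ⁻¹' {c}) ≠ ∞ := fun n c hc => by
    refine ne_top_of_le_ne_top (measure_spanningSets_lt_top Λ n).ne (measure_mono fun y hy => ?_)
    by_contra h
    rw [Set.mem_preimage, hFa, Set.indicator_of_notMem h] at hy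
    exact hc hy.symm
  have hL : Tendsto (fun n => ∫ ω, expNeg (∑' i, F n (x i ω)) ∂P) atTop
      (𝓝 (∫ ω, expNeg (∑' i, f (x i ω)) ∂P)) := by
    refine tendsto_integral_of_dominated_convergence (fun _ => 1) (fun n => ?_)
      (integrable_const _) (fun n => ae_of_all _ fun ω => norm_expNeg_le_one _)
      (ae_of_all _ fun ω => (continuous_expNeg.tendsto _).comp ?_)
    · exact (measurable_expNeg.comp (measurable_tsum_comp hx.measurable
        (F n).measurable)).aestronglyMeasurable
    · simp_rw [← lintegral_count]
      exact lintegral_tendsto_of_tendsto_of_monotone (fun n => Measurable.of_discrete.aemeasurable)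
        (ae_of_all _ fun i => hmono _) (ae_of_all _ fun i => htend _)
  have hR : Tendsto (fun n => expNeg (∫⁻ y, ENNReal.ofReal (1 - expNeg (F n y)) ∂Λ)) atTop
      (𝓝 (expNeg (∫⁻ y, ENNReal.ofReal (1 - expNeg (f y)) ∂Λ))) := by
    refine (continuous_expNeg.tendsto _).comp ?_
    refine lintegral_tendsto_of_tendsto_of_monotone (fun n => by
      exact Measurable.aemeasurable (by fun_prop)) (ae_of_all _ fun y n k hnk => ?_)
      (ae_of_all _ fun y => ?_)
    · exact ENNReal.ofReal_le_ofReal (sub_le_sub_left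
        (expNeg_strictAnti.antitone (hmono y hnk)) _)
    · exact (ENNReal.continuous_ofReal.tendsto _).comp
        (tendsto_const_nhds.sub ((continuous_expNeg.tendsto _).comp (htend y)))
  exact tendsto_nhds_unique hL (hR.congr fun n => (laplace_simpleFunc hx (F n) (hfin n)).symm)

theorem measurable_prod_integral_expNeg {ι : Type*} [Fintype ι] {γ : Measure ℝ} [SFinite γ]
    {G : ι → E → ℝ → ℝ≥0∞} (hG : ∀ n, Measurable (Function.uncurry (G n))) :
    Measurable fun y => ∏ n, ∫ t, expNeg (G n y t) ∂γ := by
  refine Finset.measurable_fun_prod _ fun n _ => ?_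
  exact (StronglyMeasurable.integral_prod_right'
    (f := fun p : E × ℝ => expNeg (G n p.1 p.2))
    (measurable_expNeg.comp (hG n)).stronglyMeasurable).measurable

/-- Fix the locations: the marks keep their law, and for finitely many points the product over marks
integrates factor by factor. -/
theorem integral_prod_marks [IsProbabilityMeasure P] {ι : Type*} [Fintype ι]
    (hxm : ∀ i, Measurable (x i)) {h : ι → ℕ → Ω → ℝ} {γ : Measure ℝ} [IsProbabilityMeasure γ]
    (hhm : ∀ n i, Measurable (h n i)) (hlaw : ∀ n i, HasLaw (h n i) γ P)
    (hind : iIndepFun (fun p : ι × ℕ => h p.1 p.2) P)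
    (hxh : IndepFun (fun ω i => x i ω) (fun ω (p : ι × ℕ) => h p.1 p.2 ω) P)
    {G : ι → E → ℝ → ℝ≥0∞} (hG : ∀ n, Measurable (Function.uncurry (G n))) (N : ℕ) :
    ∫ ω, ∏ i : Fin N, ∏ n, expNeg (G n (x i ω) (h n i ω)) ∂P =
      ∫ ω, ∏ i : Fin N, ∏ n, ∫ t, expNeg (G n (x i ω) t) ∂γ ∂P := by
  have hG' : ∀ n, Measurable fun p : E × ℝ => G n p.1 p.2 := hG
  have hGy : ∀ n y, Measurable fun t => expNeg (G n y t) := fun n y =>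
    measurable_expNeg.comp ((hG' n).comp measurable_prodMk_left)
  let K : (ℕ → E) × (ι × ℕ → ℝ) → ℝ := fun q =>
    ∏ i : Fin N, ∏ n, expNeg (G n (q.1 i) (q.2 (n, i)))
  have hK : Measurable K := by
    refine Finset.measurable_fun_prod _ fun i _ => Finset.measurable_fun_prod _ fun n _ => ?_
    have h1 : Measurable fun q : (ℕ → E) × (ι × ℕ → ℝ) => (q.1 i, q.2 (n, i)) := by fun_prop
    have h2 : Measurable fun q : (ℕ → E) × (ι × ℕ → ℝ) => G n (q.1 i) (q.2 (n, i)) :=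
      (hG' n).comp h1
    exact measurable_expNeg.comp h2
  have hX : Measurable fun ω i => x i ω := measurable_pi_lambda _ hxm
  have hM : Measurable fun ω (p : ι × ℕ) => h p.1 p.2 ω :=
    measurable_pi_lambda _ fun p => hhm p.1 p.2
  have hbound : ∀ q, ‖K q‖ ≤ 1 := fun q => by
    simp only [K, norm_prod]
    exact Finset.prod_le_one (fun _ _ => Finset.prod_nonneg fun _ _ => norm_nonneg _)
      fun _ _ => Finset.prod_le_one (fun _ _ => norm_nonneg _) fun _ _ => norm_expNeg_le_one _
  have hinner : ∀ ξ : ℕ → E, ∫ m, K (ξ, m) ∂(P.map fun ω (p : ι × ℕ) => h p.1 p.2 ω) =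
      ∏ i : Fin N, ∏ n, ∫ t, expNeg (G n (ξ i) t) ∂γ := fun ξ => by
    have hKξ : Measurable fun m => K (ξ, m) := hK.comp measurable_prodMk_left
    rw [integral_map hM.aemeasurable hKξ.aestronglyMeasurable]
    have hinj : Function.Injective fun p : Fin N × ι => ((p.2, (p.1 : ℕ)) : ι × ℕ) := by
      rintro ⟨i, n⟩ ⟨j, k⟩ hp
      simp only [Prod.mk.injEq] at hp
      exact Prod.ext (Fin.ext hp.2) hp.1
    have hI := (hind.precomp hinj).integral_fun_prod_comp
      (f := fun (p : Fin N × ι) (t : ℝ) => expNeg (G p.2 (ξ p.1) t))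
      (fun p => (hhm p.2 p.1).aemeasurable) (fun p => (hGy p.2 (ξ p.1)).aestronglyMeasurable)
    simp only [Fintype.prod_prod_type] at hI
    simp only [K]
    rw [hI]
    refine Finset.prod_congr rfl fun i _ => Finset.prod_congr rfl fun n _ => ?_
    rw [← (hlaw n i).map_eq, integral_map (hhm n i).aemeasurable
      (hGy n (ξ i)).aestronglyMeasurable]
  calc ∫ ω, ∏ i : Fin N, ∏ n, expNeg (G n (x i ω) (h n i ω)) ∂P
      = ∫ q, K q ∂(P.map fun ω => ((fun i => x i ω), fun p : ι × ℕ => h p.1 p.2 ω)) := by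
        rw [integral_map (hX.prodMk hM).aemeasurable hK.aestronglyMeasurable]
    _ = ∫ ξ, ∫ m, K (ξ, m) ∂(P.map fun ω (p : ι × ℕ) => h p.1 p.2 ω)
          ∂(P.map fun ω i => x i ω) := by
        rw [(indepFun_iff_map_prod_eq_prod_map_map hX.aemeasurable hM.aemeasurable).1 hxh,
          integral_prod]
        exact Integrable.of_bound hK.aestronglyMeasurable 1 (ae_of_all _ hbound)
    _ = ∫ ω, ∏ i : Fin N, ∏ n, ∫ t, expNeg (G n (x i ω) t) ∂γ ∂P := by
        simp_rw [hinner]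
        rw [integral_map hX.aemeasurable]
        have hΦ := measurable_prod_integral_expNeg (γ := γ) hG
        refine Measurable.aestronglyMeasurable (Finset.measurable_fun_prod _ fun i _ => ?_)
        exact hΦ.comp (measurable_pi_apply (i : ℕ))

/-- The Laplace functional of an independently marked Poisson point process, the mark of each point
consisting of independent variables. -/
theorem laplace_functional_marked [IsProbabilityMeasure P] [SigmaFinite Λ] {ι : Type*} [Fintype ι]
    (hx : IsPoissonPointProcess P x Λ) {h : ι → ℕ → Ω → ℝ} {γ : Measure ℝ}
    (hhm : ∀ n i, Measurable (h n i)) (hlaw : ∀ n i, HasLaw (h n i) γ P)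
    (hind : iIndepFun (fun p : ι × ℕ => h p.1 p.2) P)
    (hxh : IndepFun (fun ω i => x i ω) (fun ω (p : ι × ℕ) => h p.1 p.2 ω) P)
    {G : ι → E → ℝ → ℝ≥0∞} (hG : ∀ n, Measurable (Function.uncurry (G n))) :
    ∫ ω, expNeg (∑' i, ∑ n, G n (x i ω) (h n i ω)) ∂P =
      expNeg (∫⁻ y, ENNReal.ofReal (1 - ∏ n, ∫ t, expNeg (G n y t) ∂γ) ∂Λ) := by
  -- Only an existing mark forces `γ` to be a probability measure.
  rcases isEmpty_or_nonempty ι with hι | ⟨⟨n₀⟩⟩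
  · simp
  have hγ : IsProbabilityMeasure γ := by
    rw [← (hlaw n₀ 0).map_eq]
    exact Measure.isProbabilityMeasure_map (hhm n₀ 0).aemeasurable
  have hG' : ∀ n, Measurable fun p : E × ℝ => G n p.1 p.2 := hG
  have hGy : ∀ n y, Measurable (G n y) := fun n y => (hG' n).comp measurable_prodMk_left
  set φ : E → ℝ := fun y => ∏ n, ∫ t, expNeg (G n y t) ∂γ with hφ
  have hint01 : ∀ n y, ∫ t, expNeg (G n y t) ∂γ ∈ Set.Icc (0 : ℝ) 1 := fun n y => by
    refine ⟨integral_nonneg fun t => expNeg_nonneg _, ?_⟩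
    have := integral_mono (integrable_expNeg (P := γ) (hGy n y).aemeasurable)
      (integrable_const 1) (fun t => expNeg_le_one _)
    simpa using this
  have hφ0 : ∀ y, 0 ≤ φ y := fun y => Finset.prod_nonneg fun n _ => (hint01 n y).1
  have hφ1 : ∀ y, φ y ≤ 1 := fun y => Finset.prod_le_one (fun n _ => (hint01 n y).1)
    fun n _ => (hint01 n y).2
  have hφm : Measurable φ := measurable_prod_integral_expNeg hG
  have hxm := hx.measurable
  have htsum : ∀ f : ℕ → ℝ≥0∞, Tendsto (fun N => ∏ i : Fin N, expNeg (f i)) atTop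
      (𝓝 (expNeg (∑' i, f i))) := fun f => by
    have := (continuous_expNeg.tendsto _).comp (ENNReal.summable (f := f)).hasSum.tendsto_sum_nat
    refine this.congr fun N => ?_
    rw [Function.comp_apply, expNeg_sum, Finset.prod_range]
  have hlim : ∀ f : ℕ → Ω → ℝ≥0∞, (∀ i, Measurable (f i)) →
      Tendsto (fun N => ∫ ω, ∏ i : Fin N, expNeg (f i ω) ∂P) atTop
        (𝓝 (∫ ω, expNeg (∑' i, f i ω) ∂P)) := fun f hf => by
    refine tendsto_integral_of_dominated_convergence (fun _ => 1) (fun n => ?_)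
      (integrable_const _) (fun n => ae_of_all _ fun ω => ?_)
      (ae_of_all _ fun ω => htsum fun i => f i ω)
    · refine Measurable.aestronglyMeasurable ?_
      fun_prop
    · rw [norm_prod]
      exact Finset.prod_le_one (fun _ _ => norm_nonneg _) fun _ _ => norm_expNeg_le_one _
  -- Averaging the marks replaces the factor of each point by `φ`; written as an exponential, it
  -- falls under the unmarked functional with `f = negLog ∘ φ`.
  have hnl : ∀ y, expNeg (negLog (φ y)) = φ y := fun y => expNeg_negLog (hφ0 y) (hφ1 y)
  have hterm : ∀ n i, Measurable fun ω => G n (x i ω) (h n i ω) := fun n i => by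
    have h1 : Measurable fun ω => (x i ω, h n i ω) := (hxm i).prodMk (hhm n i)
    exact (hG' n).comp h1
  have h1 := hlim (fun i ω => ∑ n, G n (x i ω) (h n i ω)) fun i =>
    Finset.measurable_fun_sum _ fun n _ => hterm n i
  have h2 := hlim (fun i ω => negLog (φ (x i ω))) fun i => by
    fun_prop
  simp_rw [expNeg_sum] at h1
  simp_rw [hnl] at h2
  rw [tendsto_nhds_unique h1 (h2.congr fun N =>
      (integral_prod_marks hxm hhm hlaw hind hxh hG N).symm),
    laplace_functional hx (f := fun y => negLog (φ y)) (by fun_prop)]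
  simp_rw [hnl, hφ]

end Laplace

/-! ### Gamma tails against the exponential -/

theorem ae_gammaMeasure_pos (a r : ℝ) : ∀ᵐ x ∂gammaMeasure a r, 0 < x := by
  have h := lintegral_gammaMeasure (a := a) (r := r)
    (f := (Set.Iic (0 : ℝ)).indicator 1) (measurable_one.indicator measurableSet_Iic)
  rw [lintegral_indicator_one measurableSet_Iic, setLIntegral_eq_zero measurableSet_Ioi] at h
  · rw [ae_iff]
    convert! h using 2
    ext x
    simp
  · intro x hx
    have hx : x ∉ Set.Iic (0 : ℝ) := fun h =>
      lt_irrefl (0 : ℝ) (lt_of_lt_of_le hx h)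
    simp [Set.indicator_of_notMem hx]

theorem gammaMeasure_subsingleton (a r : ℝ) {s : Set ℝ} (hs : s.Subsingleton) :
    gammaMeasure a r s = 0 :=
  withDensity_absolutelyContinuous _ _ (hs.measure_zero _)

theorem gammaMeasure_one_one_lt (s : ℝ≥0∞) :
    gammaMeasure 1 1 {e | ENNReal.ofReal e < s} = ENNReal.ofReal (1 - expNeg s) := by
  have := isProbabilityMeasure_gammaMeasure one_pos one_pos
  induction s using ENNReal.recTopCoe with
  | top => simp
  | coe r =>
    have hset : ({e : ℝ | ENNReal.ofReal e < (r : ℝ≥0∞)} : Set ℝ) =ᵐ[gammaMeasure 1 1]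
        Set.Iic (r : ℝ) := by
      have hne : ∀ᵐ e : ℝ ∂gammaMeasure 1 1, e ≠ r := by
        rw [ae_iff]
        simpa using gammaMeasure_subsingleton 1 1 (Set.subsingleton_singleton (a := (r : ℝ)))
      filter_upwards [hne, ae_gammaMeasure_pos 1 1] with e he h0
      refine propext ?_
      change ENNReal.ofReal e < (r : ℝ≥0∞) ↔ e ≤ r
      rw [ENNReal.ofReal_lt_coe_iff h0.le, lt_iff_le_and_ne, and_iff_left he]
    have hcdf := cdf_expMeasure_eq one_pos (r : ℝ)
    rw [if_pos r.coe_nonneg, one_mul] at hcdf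
    rw [measure_congr hset, ← ofReal_cdf, expNeg_coe, ← hcdf]
    rfl

/-- The gamma density is at most a constant times the unit exponential density, because `x^(D-1) ≤
exp (x (D-1))`. -/
theorem gammaMeasure_lt_le {D : ℕ} (hD : 1 ≤ D) (s : ℝ≥0∞) :
    gammaMeasure D D {g | ENNReal.ofReal g < s} ≤
      ENNReal.ofReal ((D : ℝ) ^ (D : ℝ) / Real.Gamma D) * ENNReal.ofReal (1 - expNeg s) := by
  have hD' : (1 : ℝ) ≤ D := by exact_mod_cast hD
  have hm : MeasurableSet {g : ℝ | ENNReal.ofReal g < s} :=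
    measurableSet_lt (by fun_prop) measurable_const
  rw [← gammaMeasure_one_one_lt, ← lintegral_indicator_one hm, ← lintegral_indicator_one hm,
    lintegral_gammaMeasure (measurable_one.indicator hm),
    lintegral_gammaMeasure (measurable_one.indicator hm),
    ← lintegral_const_mul' _ _ ENNReal.ofReal_ne_top]
  refine setLIntegral_mono' measurableSet_Ioi fun x hx => ?_
  have hx : 0 < x := hx
  rw [← mul_assoc, ← ENNReal.ofReal_mul (by positivity)]
  refine mul_le_mul_left (ENNReal.ofReal_le_ofReal ?_) _
  rw [Real.Gamma_one, sub_self, Real.rpow_zero, Real.one_rpow, one_mul, div_one, one_mul,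
    mul_assoc]
  refine mul_le_mul_of_nonneg_left ?_ (by positivity)
  rw [show -((D : ℝ) * x) = -(x * (D - 1)) + -x by ring, Real.exp_add, ← mul_assoc]
  refine mul_le_mul_of_nonneg_right ?_ (Real.exp_nonneg _)
  rw [Real.exp_neg, Real.exp_mul, ← div_eq_mul_inv, div_le_one (by positivity)]
  exact Real.rpow_le_rpow hx.le (by linarith [Real.add_one_le_exp x]) (by linarith)

/-! ### The conditional outage probability -/

/-- The inverse of the normalized combiner output, for desired gains `g` and interference `s`, is
compared with `1`: this is the event that the combiner output stays below threshold. -/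
def outageSet (s : ℝ≥0∞ × ℝ≥0∞) : Set (ℝ × ℝ) :=
  {g | ENNReal.ofReal g.1 / s.1 + ENNReal.ofReal g.2 / s.2 < 1}

theorem measurableSet_outageSet (s : ℝ≥0∞ × ℝ≥0∞) : MeasurableSet (outageSet s) :=
  measurableSet_lt (by fun_prop) measurable_const

/-- The outage probability given the normalized interference powers `s` when the desired gains are
independent gamma variables of shape and rate `D`. -/
noncomputable def condOutage (D : ℕ) (s : ℝ≥0∞ × ℝ≥0∞) : ℝ :=
  ((gammaMeasure D D).prod (gammaMeasure D D)).real (outageSet s)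

section CondOutage

variable {D : ℕ}

theorem isProbabilityMeasure_gammaMeasure_nat (hD : 1 ≤ D) :
    IsProbabilityMeasure (gammaMeasure D D) := by
  have hD' : (0 : ℝ) < D := by exact_mod_cast hD
  exact isProbabilityMeasure_gammaMeasure hD' hD'

theorem ae_prod_pos (D : ℕ) :
    ∀ᵐ g ∂(gammaMeasure D D).prod (gammaMeasure D D), 0 < g.1 ∧ 0 < g.2 := by
  exact (Measure.quasiMeasurePreserving_fst.ae (ae_gammaMeasure_pos D D)).and
    (Measure.quasiMeasurePreserving_snd.ae (ae_gammaMeasure_pos D D))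

/-- With the first gain fixed, at most one positive second gain gives equality, and gamma laws have
no atoms. -/
theorem ae_ne_one_of_snd (hD : 1 ≤ D) (s₁ : ℝ≥0∞) {s₂ : ℝ≥0∞} (h0 : s₂ ≠ 0) (h1 : s₂ ≠ ∞) :
    ∀ᵐ g ∂(gammaMeasure D D).prod (gammaMeasure D D),
      ENNReal.ofReal g.1 / s₁ + ENNReal.ofReal g.2 / s₂ ≠ 1 := by
  have := isProbabilityMeasure_gammaMeasure_nat hD
  have hm : MeasurableSet {g : ℝ × ℝ | ENNReal.ofReal g.1 / s₁ + ENNReal.ofReal g.2 / s₂ ≠ 1} :=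
    (measurableSet_eq_fun (by fun_prop) measurable_const).compl
  rw [Measure.ae_prod_iff_ae_ae hm]
  refine ae_of_all _ fun x => ?_
  have hsub : {y : ℝ | 0 < y ∧ ENNReal.ofReal x / s₁ + ENNReal.ofReal y / s₂ = 1}.Subsingleton := by
    rintro y ⟨hy, hy1⟩ z ⟨hz, hz1⟩
    have hfin : ENNReal.ofReal x / s₁ ≠ ∞ := fun h => by simp [h] at hy1
    have h2 := (ENNReal.add_right_inj hfin).1 (hy1.trans hz1.symm)
    rw [div_eq_mul_inv, div_eq_mul_inv,
      ENNReal.mul_left_inj (ENNReal.inv_ne_zero.2 h1) (ENNReal.inv_ne_top.2 h0)] at h2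
    exact (ENNReal.ofReal_eq_ofReal_iff hy.le hz.le).1 h2
  have h3 : ∀ᵐ y ∂gammaMeasure D D,
      y ∉ {y : ℝ | 0 < y ∧ ENNReal.ofReal x / s₁ + ENNReal.ofReal y / s₂ = 1} :=
    measure_eq_zero_iff_ae_notMem.1 (gammaMeasure_subsingleton _ _ hsub)
  filter_upwards [h3, ae_gammaMeasure_pos D D] with y hy hy0 h
  exact hy ⟨hy0, h⟩

theorem ae_ne_one (hD : 1 ≤ D) (s : ℝ≥0∞ × ℝ≥0∞) :
    ∀ᵐ g ∂(gammaMeasure D D).prod (gammaMeasure D D),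
      ENNReal.ofReal g.1 / s.1 + ENNReal.ofReal g.2 / s.2 ≠ 1 := by
  have := isProbabilityMeasure_gammaMeasure_nat hD
  by_cases h2 : s.2 ≠ 0 ∧ s.2 ≠ ∞
  · exact ae_ne_one_of_snd hD s.1 h2.1 h2.2
  by_cases h1 : s.1 ≠ 0 ∧ s.1 ≠ ∞
  · have h := (Measure.measurePreserving_swap (μ := gammaMeasure D D)
      (ν := gammaMeasure D D)).quasiMeasurePreserving.ae (ae_ne_one_of_snd hD s.2 h1.1 h1.2)
    filter_upwards [h] with g hg
    rw [add_comm]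
    exact hg
  -- When both entries of `s` are `0` or `∞`, the sum is `0` or `∞`.
  · filter_upwards [ae_prod_pos D] with g hg
    have e1 : ENNReal.ofReal g.1 ≠ 0 := (ENNReal.ofReal_pos.2 hg.1).ne'
    have e2 : ENNReal.ofReal g.2 ≠ 0 := (ENNReal.ofReal_pos.2 hg.2).ne'
    have h1' : s.1 = 0 ∨ s.1 = ∞ := by tauto
    have h2' : s.2 = 0 ∨ s.2 = ∞ := by tauto
    rcases h1' with h1' | h1' <;> rcases h2' with h2' | h2' <;>
      simp [h1', h2', ENNReal.div_zero e1, ENNReal.div_zero e2]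

/-- Dominated convergence: off the null boundary event, the indicator is locally constant in `s`,
also at zero and infinite interference. -/
theorem continuous_condOutage (hD : 1 ≤ D) : Continuous (condOutage D) := by
  have := isProbabilityMeasure_gammaMeasure_nat hD
  have hI : ∀ s, condOutage D s = ∫ g, (outageSet s).indicator (fun _ => (1 : ℝ)) g
      ∂(gammaMeasure D D).prod (gammaMeasure D D) := fun s => by
    rw [condOutage]
    exact (integral_indicator_one (measurableSet_outageSet s)).symm
  rw [continuous_iff_continuousAt]
  intro s
  unfold ContinuousAt
  simp_rw [funext hI]
  refine tendsto_integral_filter_of_dominated_convergence (fun _ => 1)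
    (Eventually.of_forall fun s' => ((measurable_const.indicator
      (measurableSet_outageSet s')).aestronglyMeasurable))
    (Eventually.of_forall fun s' => ae_of_all _ fun g => ?_) (integrable_const _) ?_
  · exact (norm_indicator_le_norm_self (fun _ => (1 : ℝ)) g).trans (by simp)
  · filter_upwards [ae_ne_one hD s] with g hg
    have hc : Continuous fun s : ℝ≥0∞ × ℝ≥0∞ =>
        ENNReal.ofReal g.1 / s.1 + ENNReal.ofReal g.2 / s.2 := by
      simp only [div_eq_mul_inv]
      exact ((ENNReal.continuous_const_mul ENNReal.ofReal_ne_top).comp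
        (continuous_fst.inv)).add ((ENNReal.continuous_const_mul ENNReal.ofReal_ne_top).comp
        (continuous_snd.inv))
    refine tendsto_const_nhds.congr' ?_
    rcases lt_or_gt_of_ne hg with h | h
    · filter_upwards [hc.continuousAt.eventually_lt_const h] with s' hs'
      rw [Set.indicator_of_mem (show g ∈ outageSet s from h),
        Set.indicator_of_mem (show g ∈ outageSet s' from hs')]
    · filter_upwards [hc.continuousAt.eventually_const_lt h] with s' hs'
      rw [Set.indicator_of_notMem (show g ∉ outageSet s from not_lt.2 h.le),
        Set.indicator_of_notMem (show g ∉ outageSet s' from not_lt.2 hs'.le)]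

/-- Outage of the combiner forces each branch alone to be below threshold. The two factors together
give decay faster than `1 - exp (-(s₁ + s₂))` at the origin. -/
theorem exists_condOutage_le (hD : 1 ≤ D) : ∃ C : ℝ, 0 ≤ C ∧ ∀ s : ℝ≥0∞ × ℝ≥0∞,
    condOutage D s ≤ C * ((1 - expNeg s.1) * (1 - expNeg s.2)) := by
  have := isProbabilityMeasure_gammaMeasure_nat hD
  have hD' : (0 : ℝ) < D := by exact_mod_cast hD
  set c : ℝ := (D : ℝ) ^ (D : ℝ) / Real.Gamma D with hc
  have hc0 : 0 ≤ c := by positivity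
  refine ⟨c * c, by positivity, fun s => ?_⟩
  have hsub : outageSet s ≤ᵐ[(gammaMeasure D D).prod (gammaMeasure D D)]
      {g | ENNReal.ofReal g < s.1} ×ˢ {g | ENNReal.ofReal g < s.2} := by
    filter_upwards [ae_prod_pos D] with g hg hgs
    have hdiv : ∀ {x : ℝ} {t : ℝ≥0∞}, 0 < x → ENNReal.ofReal x / t < 1 →
        ENNReal.ofReal x < t := fun {x t} hx h => by
      have ht0 : t ≠ 0 := fun h0 => by
        rw [h0, ENNReal.div_zero (ENNReal.ofReal_pos.2 hx).ne'] at h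
        exact absurd h (by simp)
      by_cases ht : t = ∞
      · rw [ht]
        exact ENNReal.ofReal_lt_top
      · rwa [ENNReal.div_lt_iff (Or.inl ht0) (Or.inl ht), one_mul] at h
    have hgs : ENNReal.ofReal g.1 / s.1 + ENNReal.ofReal g.2 / s.2 < 1 := hgs
    exact ⟨hdiv hg.1 (lt_of_le_of_lt le_self_add hgs), hdiv hg.2 (lt_of_le_of_lt le_add_self hgs)⟩
  have h1 := measure_mono_ae hsub
  rw [Measure.prod_prod] at h1
  have h2 := h1.trans (mul_le_mul' (gammaMeasure_lt_le hD s.1) (gammaMeasure_lt_le hD s.2))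
  have n1 := sub_nonneg.2 (expNeg_le_one s.1)
  have n2 := sub_nonneg.2 (expNeg_le_one s.2)
  rw [← hc, ← ENNReal.ofReal_mul hc0, ← ENNReal.ofReal_mul hc0,
    ← ENNReal.ofReal_mul (by positivity)] at h2
  have h3 := ENNReal.toReal_le_of_le_ofReal (by positivity) h2
  refine h3.trans (le_of_eq (by ring))

theorem condOutage_nonneg (s : ℝ≥0∞ × ℝ≥0∞) : 0 ≤ condOutage D s := measureReal_nonneg

/-- The conditional outage probability divided by `1 - exp (-(s₁ + s₂))`. -/
noncomputable def condOutageQuotient (hD : 1 ≤ D) : C(ℝ≥0∞ × ℝ≥0∞, ℝ) where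
  toFun s := condOutage D s / (1 - expNeg (s.1 + s.2))
  continuous_toFun := by
    rw [continuous_iff_continuousAt]
    intro s
    have hq : Continuous fun s : ℝ≥0∞ × ℝ≥0∞ => 1 - expNeg (s.1 + s.2) :=
      continuous_const.sub (continuous_expNeg.comp (by fun_prop))
    by_cases hs : s = 0
    · subst hs
      obtain ⟨C, hC, hle⟩ := exists_condOutage_le hD
      have hlim : Tendsto (fun s : ℝ≥0∞ × ℝ≥0∞ => C * (1 - expNeg s.2)) (𝓝 0) (𝓝 0) := by
        have : Continuous fun s : ℝ≥0∞ × ℝ≥0∞ => C * (1 - expNeg s.2) :=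
          continuous_const.mul (continuous_const.sub (continuous_expNeg.comp continuous_snd))
        simpa using this.tendsto 0
      unfold ContinuousAt
      -- The default `0 / 0 = 0` is the correct limiting value, since the quotient is at most `C (1
      -- - exp (-s₂))`.
      have h0 : condOutage D 0 / (1 - expNeg ((0 : ℝ≥0∞ × ℝ≥0∞).1 + (0 : ℝ≥0∞ × ℝ≥0∞).2)) = 0 := by
        simp
      simp only [h0]
      refine squeeze_zero (fun s => div_nonneg (condOutage_nonneg s)
        (sub_nonneg.2 (expNeg_le_one _))) (fun s => ?_) hlim
      have n2 := sub_nonneg.2 (expNeg_le_one s.2)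
      refine div_le_of_le_mul₀ (sub_nonneg.2 (expNeg_le_one _)) (by positivity) ((hle s).trans ?_)
      rw [mul_assoc, mul_comm (1 - expNeg s.1)]
      gcongr
      exact expNeg_strictAnti.antitone le_self_add
    · refine (continuous_condOutage hD).continuousAt.div hq.continuousAt ?_
      have : 0 < s.1 + s.2 := by
        rw [pos_iff_ne_zero]
        intro h
        exact hs (Prod.ext (add_eq_zero.1 h).1 (add_eq_zero.1 h).2)
      have := expNeg_strictAnti this
      rw [expNeg_zero] at this
      linarith

theorem condOutageQuotient_mul (hD : 1 ≤ D) (s : ℝ≥0∞ × ℝ≥0∞) :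
    condOutageQuotient hD s * (1 - expNeg (s.1 + s.2)) = condOutage D s := by
  change condOutage D s / (1 - expNeg (s.1 + s.2)) * (1 - expNeg (s.1 + s.2)) = _
  by_cases h : 1 - expNeg (s.1 + s.2) = 0
  · obtain ⟨C, hC, hle⟩ := exists_condOutage_le hD
    have h1 : expNeg s.1 = 1 := le_antisymm (expNeg_le_one _)
      ((by linarith : (1 : ℝ) ≤ expNeg (s.1 + s.2)).trans
        (expNeg_strictAnti.antitone le_self_add))
    have := hle s
    rw [h1, sub_self, zero_mul, mul_zero] at this
    rw [h, mul_zero, le_antisymm this (condOutage_nonneg s)]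
  · exact div_mul_cancel₀ _ h

end CondOutage

/-! ### Convergence of measures on `[0, ∞]²` from Laplace transforms -/

section Convergence

/-- The coordinate function `exp (-s₁)` on `[0, ∞]²`. -/
noncomputable def expFst : C(ℝ≥0∞ × ℝ≥0∞, ℝ) :=
  ⟨fun s => expNeg s.1, continuous_expNeg.comp continuous_fst⟩

/-- The coordinate function `exp (-s₂)` on `[0, ∞]²`. -/
noncomputable def expSnd : C(ℝ≥0∞ × ℝ≥0∞, ℝ) :=
  ⟨fun s => expNeg s.2, continuous_expNeg.comp continuous_snd⟩

theorem expFst_pow_mul_expSnd_pow (j k : ℕ) (s : ℝ≥0∞ × ℝ≥0∞) :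
    (expFst ^ j * expSnd ^ k) s = expNeg (j * s.1 + k * s.2) := by
  rw [expNeg_add, mul_comm (j : ℝ≥0∞), mul_comm (k : ℝ≥0∞), expNeg_mul_natCast, expNeg_mul_natCast]
  rfl

/-- Stone–Weierstrass on the compact space `[0, ∞]²`: injectivity of `expNeg`, including at `∞`,
makes the two coordinates separate points. -/
theorem adjoin_exp_dense :
    (Algebra.adjoin ℝ {expFst, expSnd}).topologicalClosure = ⊤ := by
  refine ContinuousMap.subalgebra_topologicalClosure_eq_top_of_separatesPoints _ ?_
  intro s t hst
  by_cases h : s.1 = t.1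
  · refine ⟨_, ⟨expSnd, Algebra.subset_adjoin (by simp), rfl⟩, fun h2 => hst ?_⟩
    exact Prod.ext h (expNeg_strictAnti.injective h2)
  · exact ⟨_, ⟨expFst, Algebra.subset_adjoin (by simp), rfl⟩,
      fun h2 => h (expNeg_strictAnti.injective h2)⟩

variable {ι : Type*} {l : Filter ι}

/-- The weight `1 - exp (-(s₁ + s₂))` makes `ν` finite even if it has infinite mass near the origin,
and the rescaled weighted masses stay eventually bounded. Convergence therefore passes from a dense
algebra to its uniform closure. -/
theorem tendsto_of_tendsto_laplace {m : ι → Measure (ℝ≥0∞ × ℝ≥0∞)} [∀ i, IsFiniteMeasure (m i)]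
    {ν : Measure (ℝ≥0∞ × ℝ≥0∞)} {ρ : ι → ℝ} (hρ : ∀ᶠ i in l, 0 ≤ ρ i)
    (hν : ∀ j k : ℕ, Integrable (fun s => 1 - expNeg (j * s.1 + k * s.2)) ν)
    (hlim : ∀ j k : ℕ, Tendsto (fun i => ρ i * ∫ s, (1 - expNeg (j * s.1 + k * s.2)) ∂m i) l
      (𝓝 (∫ s, (1 - expNeg (j * s.1 + k * s.2)) ∂ν)))
    (f : C(ℝ≥0∞ × ℝ≥0∞, ℝ)) :
    Tendsto (fun i => ρ i * ∫ s, f s * (1 - expNeg (s.1 + s.2)) ∂m i) l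
      (𝓝 (∫ s, f s * (1 - expNeg (s.1 + s.2)) ∂ν)) := by
  set q : ℝ≥0∞ × ℝ≥0∞ → ℝ := fun s => 1 - expNeg (s.1 + s.2) with hq
  have hq0 : ∀ s, 0 ≤ q s := fun s => sub_nonneg.2 (expNeg_le_one _)
  have hm : ∀ (i) (j k : ℕ), Integrable (fun s => 1 - expNeg (j * s.1 + k * s.2)) (m i) :=
    fun i j k => (integrable_const 1).sub (integrable_expNeg (by fun_prop))
  have h11 : q = fun s => 1 - expNeg (((1 : ℕ) : ℝ≥0∞) * s.1 + ((1 : ℕ) : ℝ≥0∞) * s.2) := by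
    ext s
    simp [hq]
  have hqν : Integrable q ν := h11 ▸ hν 1 1
  have hqm : ∀ i, Integrable q (m i) := fun i => h11 ▸ hm i 1 1
  have hfm : ∀ f : C(ℝ≥0∞ × ℝ≥0∞, ℝ), Measurable f := fun f => f.continuous.measurable
  have hfint : ∀ (μ : Measure (ℝ≥0∞ × ℝ≥0∞)), Integrable q μ → ∀ f : C(ℝ≥0∞ × ℝ≥0∞, ℝ),
      Integrable (fun s => f s * q s) μ := fun μ hμ f =>
    hμ.bdd_mul (c := ‖f‖) (hfm f).aestronglyMeasurable (ae_of_all _ f.norm_coe_le_norm)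
  let good : C(ℝ≥0∞ × ℝ≥0∞, ℝ) → Prop := fun f =>
    Tendsto (fun i => ρ i * ∫ s, f s * q s ∂m i) l (𝓝 (∫ s, f s * q s ∂ν))
  -- A monomial times the weight is the difference of the hypothesis's integrands at `(j + 1, k +
  -- 1)` and `(j, k)`.
  have hmono : ∀ j k : ℕ, good (expFst ^ j * expSnd ^ k) := fun j k => by
    have e : ∀ s, (expFst ^ j * expSnd ^ k) s * q s =
        (1 - expNeg (((j + 1 : ℕ) : ℝ≥0∞) * s.1 + ((k + 1 : ℕ) : ℝ≥0∞) * s.2)) -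
          (1 - expNeg (j * s.1 + k * s.2)) := fun s => by
      rw [expFst_pow_mul_expSnd_pow, hq]
      have : ((j + 1 : ℕ) : ℝ≥0∞) * s.1 + ((k + 1 : ℕ) : ℝ≥0∞) * s.2 =
          (j * s.1 + k * s.2) + (s.1 + s.2) := by
        push_cast
        ring
      rw [this, expNeg_add _ (s.1 + s.2)]
      ring
    simp only [good, e]
    rw [integral_sub (hν _ _) (hν _ _)]
    simp_rw [integral_sub (hm _ _ _) (hm _ _ _), mul_sub]
    exact (hlim _ _).sub (hlim _ _)
  have hadj : ∀ f ∈ Algebra.adjoin ℝ {expFst, expSnd}, good f := by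
    intro f hf
    rw [← Subalgebra.mem_toSubmodule, Algebra.adjoin_eq_span] at hf
    induction hf using Submodule.span_induction with
    | mem f hf =>
      obtain ⟨j, k, rfl⟩ := (Submonoid.mem_closure_pair _ _ _).1 hf
      exact hmono j k
    | zero => simp [good, tendsto_const_nhds]
    | add f g _ _ hf hg =>
      simp only [good, ContinuousMap.add_apply, add_mul] at hf hg ⊢
      rw [integral_add (hfint ν hqν f) (hfint ν hqν g)]
      simp_rw [integral_add (hfint _ (hqm _) f) (hfint _ (hqm _) g), mul_add]
      exact hf.add hg
    | smul c f _ hf =>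
      simp only [good, ContinuousMap.smul_apply, smul_eq_mul, mul_assoc, integral_const_mul] at hf ⊢
      simp_rw [mul_left_comm _ c]
      exact hf.const_mul c
  have hone : good 1 := by simpa using hmono 0 0
  simp only [good, ContinuousMap.one_apply, one_mul] at hone
  have hdiff : ∀ (μ : Measure (ℝ≥0∞ × ℝ≥0∞)), Integrable q μ → ∀ f g : C(ℝ≥0∞ × ℝ≥0∞, ℝ),
      |∫ s, f s * q s ∂μ - ∫ s, g s * q s ∂μ| ≤ ‖f - g‖ * ∫ s, q s ∂μ := fun μ hμ f g => by
    rw [← integral_sub (hfint μ hμ f) (hfint μ hμ g), ← integral_const_mul]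
    rw [← Real.norm_eq_abs]
    refine norm_integral_le_of_norm_le (hμ.const_mul _) (ae_of_all _ fun s => ?_)
    rw [← sub_mul, norm_mul, Real.norm_of_nonneg (hq0 s)]
    exact mul_le_mul_of_nonneg_right ((f - g).norm_coe_le_norm s) (hq0 s)
  set B := ∫ s, q s ∂ν with hB
  have hB0 : 0 ≤ B := integral_nonneg hq0
  rw [Metric.tendsto_nhds]
  intro ε hε
  have hfd : f ∈ closure ((Algebra.adjoin ℝ {expFst, expSnd} : Subalgebra ℝ C(ℝ≥0∞ × ℝ≥0∞, ℝ)) :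
      Set C(ℝ≥0∞ × ℝ≥0∞, ℝ)) := by
    rw [← Subalgebra.topologicalClosure_coe, adjoin_exp_dense]
    trivial
  -- `B + 1` eventually bounds the rescaled weighted masses as well as that of `ν`, so each
  -- replacement of `f` by `p` costs less than `ε / 3`.
  obtain ⟨p, hp, hfp⟩ := Metric.mem_closure_iff.1 hfd (ε / (3 * (B + 1))) (by positivity)
  rw [dist_eq_norm] at hfp
  have hp1 := Metric.tendsto_nhds.1 (hadj p hp) (ε / 3) (by positivity)
  have hb := hone.eventually_lt_const (lt_add_one B)
  filter_upwards [hp1, hb, hρ] with i h1 h2 h3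
  rw [Real.dist_eq] at h1 ⊢
  have d1 := mul_le_mul_of_nonneg_left (hdiff (m i) (hqm i) f p) h3
  have d2 := hdiff ν hqν f p
  have hn := norm_nonneg (f - p)
  have e1 : ‖f - p‖ * (B + 1) < ε / 3 := by
    rw [lt_div_iff₀ (by positivity)] at hfp
    linarith
  have e2 : |ρ i * ∫ s, f s * q s ∂m i - ρ i * ∫ s, p s * q s ∂m i| ≤ ‖f - p‖ * (B + 1) := by
    rw [← mul_sub, abs_mul, abs_of_nonneg h3]
    refine d1.trans ?_
    rw [mul_left_comm]
    exact mul_le_mul_of_nonneg_left h2.le hn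
  have e3 : |∫ s, f s * q s ∂ν - ∫ s, p s * q s ∂ν| ≤ ‖f - p‖ * (B + 1) :=
    d2.trans (mul_le_mul_of_nonneg_left (by linarith) hn)
  rw [abs_lt] at h1 ⊢
  rw [abs_le] at e2 e3
  constructor <;> linarith [e2.1, e2.2, e3.1, e3.2, h1.1, h1.2]

end Convergence

/-! ### The path gain of a planar point under Lebesgue measure -/

section PathGain

variable {α : ℝ}

@[fun_prop]
theorem measurable_pathGain (α : ℝ) :
    Measurable fun y : EuclideanSpace ℝ (Fin 2) => ‖y‖ₑ ^ (-α) :=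
  measurable_enorm.pow_const _

theorem volume_lt_pathGain (hα : 0 < α) {z : ℝ} (hz : 0 < z) :
    volume {y : EuclideanSpace ℝ (Fin 2) | ENNReal.ofReal z < ‖y‖ₑ ^ (-α)} =
      ENNReal.ofReal (Real.pi * z ^ (-(2 / α))) := by
  have hr : 0 < z ^ (-α⁻¹) := Real.rpow_pos_of_pos hz _
  have hset : {y : EuclideanSpace ℝ (Fin 2) | ENNReal.ofReal z < ‖y‖ₑ ^ (-α)} =
      Metric.ball 0 (z ^ (-α⁻¹)) := by
    ext y
    have e : ENNReal.ofReal z = ENNReal.ofReal (z ^ (-α⁻¹)) ^ (-α) := by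
      rw [ENNReal.ofReal_rpow_of_pos hr, ← Real.rpow_mul hz.le, neg_mul_neg,
        inv_mul_cancel₀ hα.ne', Real.rpow_one]
    rw [Set.mem_ofPred_eq, e, ENNReal.rpow_neg, ENNReal.rpow_neg, ENNReal.inv_lt_inv,
      ENNReal.rpow_lt_rpow_iff hα, mem_ball_zero_iff, ← ofReal_norm,
      ENNReal.ofReal_lt_ofReal_iff hr]
  rw [hset, EuclideanSpace.volume_ball_fin_two, ← ENNReal.ofReal_pow hr.le,
    ← ENNReal.ofReal_mul (by positivity), mul_comm, ← Real.rpow_natCast, ← Real.rpow_mul hz.le]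
  congr 3
  push_cast
  ring

/-- Tonelli: for fixed `ω` the points satisfying the inequality form a disc. -/
theorem lintegral_measure_lt_pathGain (hα : 0 < α) {X : Type*} [MeasurableSpace X] {μ : Measure X}
    [SFinite μ] {Z : X → ℝ} (hZ : Measurable Z) (hpos : ∀ᵐ ω ∂μ, 0 < Z ω) :
    ∫⁻ y : EuclideanSpace ℝ (Fin 2), μ {ω | ENNReal.ofReal (Z ω) < ‖y‖ₑ ^ (-α)} =
      ∫⁻ ω, ENNReal.ofReal (Real.pi * Z ω ^ (-(2 / α))) ∂μ := by
  have hS : MeasurableSet {p : EuclideanSpace ℝ (Fin 2) × X |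
      ENNReal.ofReal (Z p.2) < ‖p.1‖ₑ ^ (-α)} :=
    measurableSet_lt (by fun_prop) ((measurable_pathGain α).comp measurable_fst)
  have h1 := Measure.prod_apply (μ := volume) (ν := μ) hS
  have h2 := Measure.prod_apply_symm (μ := volume) (ν := μ) hS
  refine (h1.symm.trans h2).trans (lintegral_congr_ae ?_)
  filter_upwards [hpos] with ω hω
  exact volume_lt_pathGain hα hω

/-- Scaling the gain by `a` dilates the plane by `a^(-1/α)`, with area factor `a^(2/α)`. This is the
origin of `T^(2/α)`. -/
theorem lintegral_comp_mul_pathGain (hα : 0 < α) {a : ℝ} (ha : 0 < a) {F : ℝ≥0∞ → ℝ≥0∞}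
    (hF : Measurable F) :
    ∫⁻ y : EuclideanSpace ℝ (Fin 2), F (ENNReal.ofReal a * ‖y‖ₑ ^ (-α)) =
      ENNReal.ofReal (a ^ (2 / α)) * ∫⁻ y : EuclideanSpace ℝ (Fin 2), F (‖y‖ₑ ^ (-α)) := by
  set r := a ^ (-α⁻¹) with hr'
  have hr : 0 < r := Real.rpow_pos_of_pos ha _
  have e : ∀ y : EuclideanSpace ℝ (Fin 2),
      ENNReal.ofReal a * ‖y‖ₑ ^ (-α) = ‖r • y‖ₑ ^ (-α) := fun y => by
    have h1 : ‖r‖ₑ ^ (-α) = ENNReal.ofReal a := by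
      rw [Real.enorm_eq_ofReal hr.le, ENNReal.ofReal_rpow_of_pos hr, hr', ← Real.rpow_mul ha.le,
        neg_mul_neg, inv_mul_cancel₀ hα.ne', Real.rpow_one]
    rw [enorm_smul, ENNReal.mul_rpow_of_ne_top enorm_ne_top enorm_ne_top, h1]
  simp_rw [e]
  rw [← lintegral_map (f := fun y : EuclideanSpace ℝ (Fin 2) => F (‖y‖ₑ ^ (-α))) (by fun_prop)
    (measurable_const_smul r), Measure.map_addHaar_smul volume hr.ne', lintegral_smul_measure,
    smul_eq_mul, finrank_euclideanSpace_fin]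
  congr 2
  rw [abs_of_pos (by positivity), hr', ← Real.rpow_natCast, ← Real.rpow_mul ha.le,
    ← Real.rpow_neg ha.le]
  congr 1
  push_cast
  ring

end PathGain

/-! ### The intensity of the pair of received powers -/

section Intensity

variable {α mI : ℝ} {mD : ℕ}

/-- The powers received at the two antennas from an interferer at `p.1` with fading gains `p.2`. -/
noncomputable def receivedPair (α : ℝ) (p : EuclideanSpace ℝ (Fin 2) × ℝ × ℝ) : ℝ≥0∞ × ℝ≥0∞ :=
  (ENNReal.ofReal p.2.1 * ‖p.1‖ₑ ^ (-α), ENNReal.ofReal p.2.2 * ‖p.1‖ₑ ^ (-α))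

@[fun_prop]
theorem measurable_receivedPair (α : ℝ) : Measurable (receivedPair α) := by
  unfold receivedPair
  fun_prop

/-- The intensity measure on `[0, ∞]²` of the received powers from a planar point process of
unit density with gamma distributed fading. -/
noncomputable def pairIntensity (α mI : ℝ) : Measure (ℝ≥0∞ × ℝ≥0∞) :=
  (volume.prod ((gammaMeasure mI mI).prod (gammaMeasure mI mI))).map (receivedPair α)

theorem lintegral_pairIntensity (hmI : 0 < mI) {F : ℝ≥0∞ × ℝ≥0∞ → ℝ≥0∞} (hF : Measurable F) :
    ∫⁻ s, F s ∂pairIntensity α mI = ∫⁻ y : EuclideanSpace ℝ (Fin 2), ∫⁻ t, F (receivedPair α (y, t))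
      ∂(gammaMeasure mI mI).prod (gammaMeasure mI mI) := by
  have := isProbabilityMeasure_gammaMeasure hmI hmI
  rw [pairIntensity, lintegral_map hF (measurable_receivedPair α),
    lintegral_prod _ (by fun_prop)]

theorem ofReal_div_ofReal_mul {g t : ℝ} (ht : 0 < t) (R : ℝ≥0∞) :
    ENNReal.ofReal g / (ENNReal.ofReal t * R) = ENNReal.ofReal (g / t) / R := by
  rw [ENNReal.ofReal_div_of_pos ht, div_eq_mul_inv, div_eq_mul_inv, div_eq_mul_inv,
    ENNReal.mul_inv (Or.inl (ENNReal.ofReal_pos.2 ht).ne') (Or.inl ENNReal.ofReal_ne_top),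
    mul_assoc]

/-- Since `1 - exp (-s)` is the probability that a unit exponential `E` lies below `s`, the integral
is `π` times the moment of order `-2/α` of `E / h` with `h` the fading gain, which is finite because
`2/α < 1`. -/
theorem lintegral_one_sub_expNeg (hα : 2 < α) (hmI : 0 < mI) :
    ∫⁻ y : EuclideanSpace ℝ (Fin 2), ∫⁻ t, ENNReal.ofReal
      (1 - expNeg (ENNReal.ofReal t * ‖y‖ₑ ^ (-α))) ∂gammaMeasure mI mI ≠ ∞ := by
  have hα0 : 0 < α := by linarith
  have := isProbabilityMeasure_gammaMeasure hmI hmI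
  have : IsProbabilityMeasure (gammaMeasure 1 1) :=
    isProbabilityMeasure_gammaMeasure one_pos one_pos
  have hpos : ∀ᵐ p ∂(gammaMeasure mI mI).prod (gammaMeasure 1 1), 0 < p.1 ∧ 0 < p.2 :=
    (Measure.quasiMeasurePreserving_fst.ae (ae_gammaMeasure_pos mI mI)).and
      (Measure.quasiMeasurePreserving_snd.ae (ae_gammaMeasure_pos 1 1))
  have e : ∀ y : EuclideanSpace ℝ (Fin 2), ∫⁻ t, ENNReal.ofReal
      (1 - expNeg (ENNReal.ofReal t * ‖y‖ₑ ^ (-α))) ∂gammaMeasure mI mI =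
      (gammaMeasure mI mI).prod (gammaMeasure 1 1)
        {p | ENNReal.ofReal (p.2 / p.1) < ‖y‖ₑ ^ (-α)} := fun y => by
    simp_rw [← gammaMeasure_one_one_lt]
    have hS : MeasurableSet {p : ℝ × ℝ | ENNReal.ofReal p.2 < ENNReal.ofReal p.1 * ‖y‖ₑ ^ (-α)} :=
      measurableSet_lt (by fun_prop) (by fun_prop)
    refine (Measure.prod_apply (μ := gammaMeasure mI mI) (ν := gammaMeasure 1 1) hS).symm.trans ?_
    refine measure_congr ?_
    filter_upwards [hpos] with p hp
    have h1 := ENNReal.ofReal_pos.2 hp.1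
    refine propext ?_
    change _ < _ ↔ _ < _
    rw [ENNReal.ofReal_div_of_pos hp.1, ENNReal.div_lt_iff (Or.inl h1.ne')
      (Or.inl ENNReal.ofReal_ne_top), mul_comm]
  simp_rw [e]
  rw [lintegral_measure_lt_pathGain hα0 (by fun_prop) (by
    filter_upwards [hpos] with p hp using div_pos hp.2 hp.1), lintegral_prod _ (by fun_prop)]
  have hδ : 0 < 2 / α := by positivity
  have hδ1 : 2 / α < 1 := (div_lt_one hα0).2 hα
  rw [lintegral_gamma_ratio_rate one_pos hmI one_pos hmI
    (f := fun v => ENNReal.ofReal (Real.pi * v ^ (-(2 / α)))) (by fun_prop)]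
  have e2 : ∀ᵐ v ∂betaPrime 1 mI, ENNReal.ofReal (Real.pi * (mI / 1 * v) ^ (-(2 / α))) =
      ENNReal.ofReal (Real.pi * mI ^ (-(2 / α))) * ENNReal.ofReal (v ^ (-(2 / α))) := by
    filter_upwards [ae_betaPrime_pos 1 mI] with v hv
    rw [← ENNReal.ofReal_mul (by positivity), div_one, Real.mul_rpow hmI.le hv.le, mul_assoc]
  rw [lintegral_congr_ae e2, lintegral_const_mul' _ _ ENNReal.ofReal_ne_top,
    lintegral_betaPrime_rpow_neg hmI hδ hδ1]
  exact ENNReal.mul_ne_top ENNReal.ofReal_ne_top ENNReal.ofReal_ne_top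

theorem one_sub_expNeg_add_le (s t : ℝ≥0∞) :
    1 - expNeg (s + t) ≤ (1 - expNeg s) + (1 - expNeg t) := by
  rw [expNeg_add]
  nlinarith [expNeg_le_one s, expNeg_le_one t]

theorem one_sub_expNeg_natCast_mul_le (n : ℕ) (s : ℝ≥0∞) :
    1 - expNeg (n * s) ≤ n * (1 - expNeg s) := by
  induction n with
  | zero => simp
  | succ n ih =>
    have := one_sub_expNeg_add_le (n * s) s
    push_cast
    rw [add_mul, one_mul]
    linarith

theorem integrable_one_sub_expNeg_pairIntensity (hα : 2 < α) (hmI : 0 < mI) (j k : ℕ) :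
    Integrable (fun s => 1 - expNeg (j * s.1 + k * s.2)) (pairIntensity α mI) := by
  have := isProbabilityMeasure_gammaMeasure hmI hmI
  have hfin := lintegral_one_sub_expNeg hα hmI
  have h1 : Integrable (fun s : ℝ≥0∞ × ℝ≥0∞ => 1 - expNeg s.1) (pairIntensity α mI) := by
    refine ⟨Measurable.aestronglyMeasurable (by fun_prop), ?_⟩
    rw [hasFiniteIntegral_iff_ofReal (ae_of_all _ fun s => sub_nonneg.2 (expNeg_le_one _)),
      lintegral_pairIntensity hmI (by fun_prop)]
    refine lt_of_le_of_lt (le_of_eq (lintegral_congr fun y => ?_)) hfin.lt_top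
    exact (measurePreserving_fst (μ := gammaMeasure mI mI) (ν := gammaMeasure mI mI)).lintegral_comp
      (f := fun t => ENNReal.ofReal (1 - expNeg (ENNReal.ofReal t * ‖y‖ₑ ^ (-α)))) (by fun_prop)
  have h2 : Integrable (fun s : ℝ≥0∞ × ℝ≥0∞ => 1 - expNeg s.2) (pairIntensity α mI) := by
    refine ⟨Measurable.aestronglyMeasurable (by fun_prop), ?_⟩
    rw [hasFiniteIntegral_iff_ofReal (ae_of_all _ fun s => sub_nonneg.2 (expNeg_le_one _)),
      lintegral_pairIntensity hmI (by fun_prop)]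
    refine lt_of_le_of_lt (le_of_eq (lintegral_congr fun y => ?_)) hfin.lt_top
    exact (measurePreserving_snd (μ := gammaMeasure mI mI) (ν := gammaMeasure mI mI)).lintegral_comp
      (f := fun t => ENNReal.ofReal (1 - expNeg (ENNReal.ofReal t * ‖y‖ₑ ^ (-α)))) (by fun_prop)
  refine ((h1.const_mul j).add (h2.const_mul k)).mono'
    (Measurable.aestronglyMeasurable (by fun_prop)) (ae_of_all _ fun s => ?_)
  rw [Real.norm_of_nonneg (sub_nonneg.2 (expNeg_le_one _))]
  exact (one_sub_expNeg_add_le _ _).trans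
    (add_le_add (one_sub_expNeg_natCast_mul_le j s.1) (one_sub_expNeg_natCast_mul_le k s.2))

end Intensity

/-! ### Integral of the conditional outage against the pair intensity -/

section Intensity

variable {α mI : ℝ} {mD : ℕ}

/-- Tonelli regroups four independent gammas into two independent ratios; `m / D` is the quotient of
their rates. -/
theorem lintegral_prod_ratio {m D : ℝ} (hm : 0 < m) (hD : 0 < D) {F : ℝ → ℝ → ℝ≥0∞}
    (hF : Measurable (Function.uncurry F)) :
    ∫⁻ p, F (p.2.1 / p.1.1) (p.2.2 / p.1.2) ∂((gammaMeasure m m).prod (gammaMeasure m m)).prod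
      ((gammaMeasure D D).prod (gammaMeasure D D)) =
    ∫⁻ v, ∫⁻ w, F (m / D * v) (m / D * w) ∂betaPrime D m ∂betaPrime D m := by
  have := isProbabilityMeasure_gammaMeasure hm hm
  have := isProbabilityMeasure_gammaMeasure hD hD
  have := isProbabilityMeasure_betaPrime hD hm
  have hF' : ∀ {X : Type} [MeasurableSpace X] {f g : X → ℝ}, Measurable f → Measurable g →
      Measurable fun x => F (f x) (g x) := fun hf hg => hF.comp (hf.prodMk hg)
  have hH : Measurable fun v => ∫⁻ w, F v (m / D * w) ∂betaPrime D m := by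
    refine Measurable.lintegral_prod_right' (f := fun p : ℝ × ℝ => F p.1 (m / D * p.2)) ?_
    exact hF' (by fun_prop) (by fun_prop)
  have hin : ∀ v, ∫⁻ t, ∫⁻ g, F v (g / t) ∂gammaMeasure D D ∂gammaMeasure m m =
      ∫⁻ w, F v (m / D * w) ∂betaPrime D m := fun v =>
    lintegral_gamma_ratio_rate hD hm hD hm (hF' measurable_const measurable_id)
  rw [← lintegral_gamma_ratio_rate hD hm hD hm hH]
  simp_rw [← hin]
  rw [lintegral_prod _ (hF' (by fun_prop) (by fun_prop)).aemeasurable, lintegral_prod]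
  · refine lintegral_congr fun t₁ => ?_
    have e : ∀ t₂, ∫⁻ g : ℝ × ℝ, F (g.1 / t₁) (g.2 / t₂)
        ∂(gammaMeasure D D).prod (gammaMeasure D D) =
        ∫⁻ g₁, ∫⁻ g₂, F (g₁ / t₁) (g₂ / t₂) ∂gammaMeasure D D ∂gammaMeasure D D := fun t₂ =>
      lintegral_prod _ (hF' (by fun_prop) (by fun_prop)).aemeasurable
    refine (lintegral_congr e).trans (lintegral_lintegral_swap ?_)
    refine (Measurable.lintegral_prod_right'
      (f := fun p : (ℝ × ℝ) × ℝ => F (p.1.2 / t₁) (p.2 / p.1.1)) ?_).aemeasurable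
    exact hF' (by fun_prop) (by fun_prop)
  · refine (Measurable.lintegral_prod_right'
      (f := fun p : (ℝ × ℝ) × (ℝ × ℝ) => F (p.2.1 / p.1.1) (p.2.2 / p.1.2)) ?_).aemeasurable
    exact hF' (by fun_prop) (by fun_prop)

/-- With a lone interferer at `y`, outage means `g₁/t₁ + g₂/t₂ < ‖y‖^(-α)`. Integrating over `y`
first leaves `π` times a negative moment of the sum, and the rate quotient comes out by homogeneity.
-/
theorem integral_condOutage_pairIntensity (hα : 2 < α) (hmI : 0 < mI) (hmD : 1 ≤ mD) :
    ∫ s, condOutage mD s ∂pairIntensity α mI =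
      Real.pi * ((mD : ℝ) / mI) ^ (2 / α) * ratioMoment α mI mD := by
  have hα0 : 0 < α := by linarith
  have hD : (0 : ℝ) < mD := by exact_mod_cast hmD
  have := isProbabilityMeasure_gammaMeasure hmI hmI
  have := isProbabilityMeasure_gammaMeasure_nat hmD
  have hM := ratioMoment_pos hα hmI hmD
  have hc := (continuous_condOutage hmD).measurable
  rw [integral_eq_lintegral_of_nonneg_ae (ae_of_all _ condOutage_nonneg) hc.aestronglyMeasurable,
    lintegral_pairIntensity hmI (by fun_prop)]
  have hpos : ∀ᵐ p ∂((gammaMeasure mI mI).prod (gammaMeasure mI mI)).prod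
      ((gammaMeasure mD mD).prod (gammaMeasure mD mD)),
      (0 < p.1.1 ∧ 0 < p.1.2) ∧ 0 < p.2.1 ∧ 0 < p.2.2 := by
    refine Filter.Eventually.and (Measure.quasiMeasurePreserving_fst.ae
      (p := fun q : ℝ × ℝ => 0 < q.1 ∧ 0 < q.2) ?_)
      (Measure.quasiMeasurePreserving_snd.ae (p := fun q : ℝ × ℝ => 0 < q.1 ∧ 0 < q.2)
        (ae_prod_pos mD))
    exact (Measure.quasiMeasurePreserving_fst.ae (ae_gammaMeasure_pos mI mI)).and
      (Measure.quasiMeasurePreserving_snd.ae (ae_gammaMeasure_pos mI mI))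
  have e : ∀ y : EuclideanSpace ℝ (Fin 2),
      ∫⁻ t, ENNReal.ofReal (condOutage mD (receivedPair α (y, t)))
      ∂(gammaMeasure mI mI).prod (gammaMeasure mI mI) =
      (((gammaMeasure mI mI).prod (gammaMeasure mI mI)).prod
        ((gammaMeasure mD mD).prod (gammaMeasure mD mD)))
        {p | ENNReal.ofReal (p.2.1 / p.1.1 + p.2.2 / p.1.2) < ‖y‖ₑ ^ (-α)} := fun y => by
    have hS : MeasurableSet {p : (ℝ × ℝ) × (ℝ × ℝ) |
        ENNReal.ofReal p.2.1 / (ENNReal.ofReal p.1.1 * ‖y‖ₑ ^ (-α)) +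
        ENNReal.ofReal p.2.2 / (ENNReal.ofReal p.1.2 * ‖y‖ₑ ^ (-α)) < 1} :=
      measurableSet_lt (by fun_prop) measurable_const
    have hm : ∀ s, ENNReal.ofReal (condOutage mD s) =
        (gammaMeasure mD mD).prod (gammaMeasure mD mD) (outageSet s) := fun s => ofReal_measureReal
    simp_rw [hm]
    refine (Measure.prod_apply (μ := (gammaMeasure mI mI).prod (gammaMeasure mI mI))
      (ν := (gammaMeasure mD mD).prod (gammaMeasure mD mD)) hS).symm.trans (measure_congr ?_)
    filter_upwards [hpos] with p hp
    refine propext ?_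
    change _ < _ ↔ _ < _
    rw [ofReal_div_ofReal_mul hp.1.1, ofReal_div_ofReal_mul hp.1.2, ENNReal.div_add_div_same,
      ← ENNReal.ofReal_add (div_pos hp.2.1 hp.1.1).le (div_pos hp.2.2 hp.1.2).le,
      ENNReal.div_lt_iff (Or.inr (ENNReal.ofReal_pos.2
        (add_pos (div_pos hp.2.1 hp.1.1) (div_pos hp.2.2 hp.1.2))).ne')
        (Or.inr ENNReal.ofReal_ne_top), one_mul]
  simp_rw [e]
  rw [lintegral_measure_lt_pathGain hα0 (by fun_prop) (by
    filter_upwards [hpos] with p hp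
    exact add_pos (div_pos hp.2.1 hp.1.1) (div_pos hp.2.2 hp.1.2)),
    lintegral_prod_ratio hmI hD
      (F := fun v w => ENNReal.ofReal (Real.pi * (v + w) ^ (-(2 / α)))) (by fun_prop)]
  have e2 : ∀ᵐ v ∂betaPrime mD mI, ∫⁻ w, ENNReal.ofReal
        (Real.pi * (mI / mD * v + mI / mD * w) ^ (-(2 / α))) ∂betaPrime mD mI =
      ENNReal.ofReal (Real.pi * ((mD : ℝ) / mI) ^ (2 / α)) *
        ∫⁻ w, ENNReal.ofReal ((v + w) ^ (-(2 / α))) ∂betaPrime mD mI := by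
    filter_upwards [ae_betaPrime_pos mD mI] with v hv
    rw [← lintegral_const_mul' _ _ ENNReal.ofReal_ne_top]
    refine lintegral_congr_ae ?_
    filter_upwards [ae_betaPrime_pos mD mI] with w hw
    rw [← ENNReal.ofReal_mul (by positivity), ← mul_add,
      Real.mul_rpow (by positivity) (by positivity), Real.rpow_neg (by positivity),
      ← Real.inv_rpow (by positivity), inv_div, mul_assoc]
  rw [lintegral_congr_ae e2, lintegral_const_mul' _ _ ENNReal.ofReal_ne_top,
    lintegral_sum_ratio_eq_ratioMoment hα hmI hmD, ← ENNReal.ofReal_mul (by positivity),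
    ENNReal.toReal_ofReal (by positivity)]

end Intensity

/-! ### The Laplace transform of the interference pair -/

section Interference

variable {Ω : Type*} [MeasurableSpace Ω] {P : Measure Ω} {lam d α mI : ℝ} {mD : ℕ}
  {x : ℕ → Ω → EuclideanSpace ℝ (Fin 2)}

theorem measurable_interference {hn : ℕ → Ω → ℝ} (hx : ∀ i, Measurable (x i))
    (hh : ∀ i, Measurable (hn i)) : Measurable (interference d α x hn) := by
  refine Measurable.const_mul (Measurable.tsum fun i => ?_) _
  exact (hh i).ennreal_ofReal.mul ((measurable_pathGain α).comp (hx i))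

/-- The pair of interference powers, scaled by the threshold `T`. -/
noncomputable def interferencePair (d α : ℝ) (x : ℕ → Ω → EuclideanSpace ℝ (Fin 2))
    (h : Fin 2 → ℕ → Ω → ℝ) (T : ℝ) (ω : Ω) : ℝ≥0∞ × ℝ≥0∞ :=
  (ENNReal.ofReal T * interference d α x (h 0) ω, ENNReal.ofReal T * interference d α x (h 1) ω)

variable {h : Fin 2 → ℕ → Ω → ℝ}

theorem measurable_interferencePair (hx : ∀ i, Measurable (x i)) (hh : ∀ n i, Measurable (h n i))
    (T : ℝ) : Measurable (interferencePair d α x h T) :=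
  ((measurable_interference hx (hh 0)).const_mul _).prodMk
    ((measurable_interference hx (hh 1)).const_mul _)

/-- The exponent is a sum over interferers, so the marked Laplace functional applies; the dilation
then extracts `(T d^α)^(2/α) = T^(2/α) d²`. -/
theorem integral_expNeg_interferencePair [IsProbabilityMeasure P] (hα : 2 < α) (hlam : 0 < lam)
    (hd : 0 < d) (hmI : 0 < mI)
    (hx : IsPoissonPointProcess P x (ENNReal.ofReal lam • volume))
    (hhm : ∀ n i, Measurable (h n i)) (hlaw : ∀ n i, HasLaw (h n i) (gammaMeasure mI mI) P)
    (hind : iIndepFun (fun p : Fin 2 × ℕ => h p.1 p.2) P)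
    (hxh : IndepFun (fun ω i => x i ω) (fun ω (p : Fin 2 × ℕ) => h p.1 p.2 ω) P)
    {T : ℝ} (hT : 0 < T) (j k : ℕ) :
    ∫ ω, expNeg (j * (interferencePair d α x h T ω).1 + k * (interferencePair d α x h T ω).2) ∂P =
      Real.exp (-(T ^ (2 / α) * (lam * d ^ 2) *
        ∫ s, (1 - expNeg (j * s.1 + k * s.2)) ∂pairIntensity α mI)) := by
  have hα0 : 0 < α := by linarith
  have := isProbabilityMeasure_gammaMeasure hmI hmI
  have ha : 0 < T * d ^ α := by positivity
  let c : Fin 2 → ℕ := ![j, k]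
  let G : Fin 2 → EuclideanSpace ℝ (Fin 2) → ℝ → ℝ≥0∞ := fun n y t =>
    c n * (ENNReal.ofReal t * (ENNReal.ofReal (T * d ^ α) * ‖y‖ₑ ^ (-α)))
  have hG : ∀ n, Measurable (Function.uncurry (G n)) := fun n => by
    simp only [G, Function.uncurry_def]
    fun_prop
  have : SigmaFinite (ENNReal.ofReal lam • (volume : Measure (EuclideanSpace ℝ (Fin 2)))) :=
    inferInstanceAs (SigmaFinite (lam.toNNReal • volume))
  have h1 := laplace_functional_marked hx hhm hlaw hind hxh hG
  have e1 : ∀ ω, ∑' i, ∑ n, G n (x i ω) (h n i ω) =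
      j * (interferencePair d α x h T ω).1 + k * (interferencePair d α x h T ω).2 := fun ω => by
    simp only [G, c, Fin.sum_univ_two, interferencePair, interference, Matrix.cons_val_zero,
      Matrix.cons_val_one]
    rw [ENNReal.tsum_add]
    simp only [← ENNReal.tsum_mul_left, ENNReal.ofReal_mul hT.le]
    congr 1 <;> exact tsum_congr fun i => by ring
  simp_rw [e1] at h1
  let F : ℝ≥0∞ → ℝ≥0∞ := fun R => ∫⁻ t, ENNReal.ofReal
    (1 - expNeg (j * (ENNReal.ofReal t.1 * R) + k * (ENNReal.ofReal t.2 * R)))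
      ∂(gammaMeasure mI mI).prod (gammaMeasure mI mI)
  have hF : Measurable F := by
    refine Measurable.lintegral_prod_right' (f := fun p : ℝ≥0∞ × ℝ × ℝ => ENNReal.ofReal
      (1 - expNeg (j * (ENNReal.ofReal p.2.1 * p.1) + k * (ENNReal.ofReal p.2.2 * p.1)))) ?_
    fun_prop
  have e2 : ∀ y : EuclideanSpace ℝ (Fin 2),
      ENNReal.ofReal (1 - ∏ n, ∫ t, expNeg (G n y t) ∂gammaMeasure mI mI) =
        F (ENNReal.ofReal (T * d ^ α) * ‖y‖ₑ ^ (-α)) := fun y => by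
    rw [Fin.prod_univ_two, ← integral_prod_mul (fun t => expNeg (G 0 y t))
      fun t => expNeg (G 1 y t)]
    simp_rw [← expNeg_add]
    have hi : Integrable (fun t : ℝ × ℝ => expNeg (G 0 y t.1 + G 1 y t.2))
        ((gammaMeasure mI mI).prod (gammaMeasure mI mI)) := by
      refine integrable_expNeg (Measurable.aemeasurable ?_)
      simp only [G]
      fun_prop
    have h3 : (1 : ℝ) - ∫ t : ℝ × ℝ, expNeg (G 0 y t.1 + G 1 y t.2)
        ∂(gammaMeasure mI mI).prod (gammaMeasure mI mI) =
        ∫ t : ℝ × ℝ, (1 - expNeg (G 0 y t.1 + G 1 y t.2))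
        ∂(gammaMeasure mI mI).prod (gammaMeasure mI mI) := by
      rw [integral_sub (integrable_const _) hi]
      simp
    rw [h3, ofReal_integral_eq_lintegral_ofReal
      (f := fun t : ℝ × ℝ => 1 - expNeg (G 0 y t.1 + G 1 y t.2)) ((integrable_const _).sub hi)
      (ae_of_all _ fun t => sub_nonneg.2 (expNeg_le_one _))]
    simp [F, G, c]
  simp_rw [e2] at h1
  rw [lintegral_smul_measure, lintegral_comp_mul_pathGain hα0 ha hF] at h1
  have e3 : ∫⁻ y : EuclideanSpace ℝ (Fin 2), F (‖y‖ₑ ^ (-α)) =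
      ENNReal.ofReal (∫ s, (1 - expNeg (j * s.1 + k * s.2)) ∂pairIntensity α mI) := by
    rw [ofReal_integral_eq_lintegral_ofReal (integrable_one_sub_expNeg_pairIntensity hα hmI j k)
      (ae_of_all _ fun t => sub_nonneg.2 (expNeg_le_one _)),
      lintegral_pairIntensity hmI (by fun_prop)]
    rfl
  have hI : 0 ≤ ∫ s, (1 - expNeg (j * s.1 + k * s.2)) ∂pairIntensity α mI :=
    integral_nonneg fun s => sub_nonneg.2 (expNeg_le_one _)
  rw [h1, e3, smul_eq_mul, ← ENNReal.ofReal_mul (by positivity), ← ENNReal.ofReal_mul hlam.le,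
    expNeg_ofReal (by positivity), Real.mul_rpow hT.le (by positivity), ← Real.rpow_mul hd.le,
    mul_div_cancel₀ _ hα0.ne']
  congr 2
  rw [show d ^ (2 : ℝ) = d ^ 2 from Real.rpow_natCast d 2]
  ring

end Interference

/-! ### Independence of the desired gains from the interference -/

section Independence

variable {Ω : Type*} [MeasurableSpace Ω] {P : Measure Ω}

theorem indepFun_prodMk_of_indepFun [IsFiniteMeasure P] {A B C : Type*} [MeasurableSpace A]
    [MeasurableSpace B] [MeasurableSpace C] {X : Ω → A} {Y : Ω → B} {Z : Ω → C}
    (hX : Measurable X) (hY : Measurable Y) (hZ : Measurable Z)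
    (hXYZ : IndepFun X (fun ω => (Y ω, Z ω)) P) (hYZ : IndepFun Y Z P)
    (hXY : IndepFun X Y P) : IndepFun (fun ω => (X ω, Y ω)) Z P := by
  rw [indepFun_iff_map_prod_eq_prod_map_map (by fun_prop) (by fun_prop)] at hXYZ hYZ hXY ⊢
  rw [hXY]
  have e : (fun ω => ((X ω, Y ω), Z ω)) =
      MeasurableEquiv.prodAssoc.symm ∘ fun ω => (X ω, (Y ω, Z ω)) := rfl
  rw [e, ← Measure.map_map (MeasurableEquiv.measurable _) (by fun_prop), hXYZ, hYZ,
    ← Measure.prodAssoc_prod, Measure.map_map (MeasurableEquiv.measurable _)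
      (MeasurableEquiv.measurable _), MeasurableEquiv.symm_comp_self, Measure.map_id]

theorem indepFun_pi_of_disjoint {ι κ κ' : Type*} {A : ι → Type*} [∀ i, MeasurableSpace (A i)]
    {f : ∀ i, Ω → A i} (hf : ∀ i, Measurable (f i)) (hind : iIndepFun f P) (u : κ → ι) (v : κ' → ι)
    (huv : ∀ a b, u a ≠ v b) :
    IndepFun (fun ω a => f (u a) ω) (fun ω b => f (v b) ω) P := by
  have h := indep_iSup_of_disjoint (fun i => (hf i).comap_le) hind
    (S := Set.range u) (T := Set.range v) (Set.disjoint_left.2 (by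
      rintro _ ⟨a, rfl⟩ ⟨b, hb⟩
      exact huv a b hb.symm))
  refine indep_of_indep_of_le_left (indep_of_indep_of_le_right h ?_) ?_
  · rw [MeasurableSpace.pi, MeasurableSpace.comap_iSup]
    refine iSup_le fun b => ?_
    rw [MeasurableSpace.comap_comp]
    exact le_iSup₂_of_le (v b) ⟨b, rfl⟩ le_rfl
  · rw [MeasurableSpace.pi, MeasurableSpace.comap_iSup]
    refine iSup_le fun b => ?_
    rw [MeasurableSpace.comap_comp]
    exact le_iSup₂_of_le (u b) ⟨b, rfl⟩ le_rfl

end Independence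

/-! ### The outage probability -/

section Outage

variable {Ω : Type*} [MeasurableSpace Ω] {P : Measure Ω} {lam d α mI : ℝ} {mD : ℕ}
  {x : ℕ → Ω → EuclideanSpace ℝ (Fin 2)} {g : Fin 2 → Ω → ℝ} {h : Fin 2 → ℕ → Ω → ℝ}

/-- The interference pair depends only on locations and interfering gains, hence is independent of
the desired gains, and the outage event can be integrated over the latter first. -/
theorem one_sub_successProb [IsProbabilityMeasure P] (hmD : 1 ≤ mD)
    (hnet : IsNetwork P 2 lam mI mD x g h) {T : ℝ} (hT : 0 < T) :
    1 - successProb P ∞ d α x g h T =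
      ∫ s, condOutage mD s ∂P.map (interferencePair d α x h T) := by
  have := isProbabilityMeasure_gammaMeasure_nat hmD
  have hS := measurable_interferencePair (d := d) (α := α) hnet.poisson.measurable
    hnet.measurable_h T
  have hg : Measurable fun ω => (g 0 ω, g 1 ω) :=
    (hnet.measurable_g 0).prodMk (hnet.measurable_g 1)
  have hfm : ∀ j : Fin 2 ⊕ (Fin 2 × ℕ), Measurable fun ω =>
      Sum.elim (fun n => g n ω) (fun p => h p.1 p.2 ω) j := by
    rintro (n | p)
    · exact hnet.measurable_g n
    · exact hnet.measurable_h p.1 p.2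
  have hX : Measurable fun ω i => x i ω := measurable_pi_lambda _ hnet.poisson.measurable
  have hH : Measurable fun ω (p : Fin 2 × ℕ) => h p.1 p.2 ω :=
    measurable_pi_lambda _ fun p => hnet.measurable_h p.1 p.2
  have hG : Measurable fun ω n => g n ω := measurable_pi_lambda _ hnet.measurable_g
  have hHG : IndepFun (fun ω (p : Fin 2 × ℕ) => h p.1 p.2 ω) (fun ω n => g n ω) P :=
    indepFun_pi_of_disjoint hfm hnet.indep_fading Sum.inr Sum.inl fun _ _ => Sum.inr_ne_inl
  have hXHG : IndepFun (fun ω i => x i ω)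
      (fun ω => ((fun (p : Fin 2 × ℕ) => h p.1 p.2 ω), fun n => g n ω)) P :=
    hnet.indep_locations.comp (φ := id)
      (ψ := fun f : Fin 2 ⊕ (Fin 2 × ℕ) → ℝ =>
        ((fun p : Fin 2 × ℕ => f (Sum.inr p)), fun n : Fin 2 => f (Sum.inl n)))
      measurable_id (by fun_prop)
  have hXH : IndepFun (fun ω i => x i ω) (fun ω (p : Fin 2 × ℕ) => h p.1 p.2 ω) P :=
    hXHG.comp (φ := id) (ψ := Prod.fst) measurable_id measurable_fst
  have hind := indepFun_prodMk_of_indepFun hX hH hG hXHG hHG hXH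
  -- The interference as a fixed measurable function of the configuration, taking the configuration
  -- space itself as sample space.
  let Φ : (ℕ → EuclideanSpace ℝ (Fin 2)) × (Fin 2 × ℕ → ℝ) → ℝ≥0∞ × ℝ≥0∞ :=
    interferencePair d α (fun i q => q.1 i) (fun n i q => q.2 (n, i)) T
  have hΦ : Measurable Φ := measurable_interferencePair (fun i => by fun_prop)
    (fun n i => by fun_prop) T
  have hSg : IndepFun (interferencePair d α x h T) (fun ω => (g 0 ω, g 1 ω)) P :=
    hind.comp (φ := Φ) (ψ := fun f : Fin 2 → ℝ => (f 0, f 1)) hΦ (by fun_prop)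
  have hg01 : IndepFun (g 0) (g 1) P :=
    hnet.indep_fading.indepFun (i := Sum.inl 0) (j := Sum.inl 1) (by simp)
  have hlaw : P.map (fun ω => (g 0 ω, g 1 ω)) = (gammaMeasure mD mD).prod (gammaMeasure mD mD) := by
    rw [(indepFun_iff_map_prod_eq_prod_map_map (hnet.measurable_g 0).aemeasurable
      (hnet.measurable_g 1).aemeasurable).1 hg01, (hnet.law_g 0).map_eq, (hnet.law_g 1).map_eq]
  have hjoint := (indepFun_iff_map_prod_eq_prod_map_map hS.aemeasurable hg.aemeasurable).1 hSg
  rw [hlaw] at hjoint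
  let U : Set ((ℝ≥0∞ × ℝ≥0∞) × (ℝ × ℝ)) := {p | p.2 ∈ outageSet p.1}
  have hU : MeasurableSet U := by
    refine measurableSet_lt (f := fun p : (ℝ≥0∞ × ℝ≥0∞) × (ℝ × ℝ) =>
      ENNReal.ofReal p.2.1 / p.1.1 + ENNReal.ofReal p.2.2 / p.1.2) ?_ measurable_const
    fun_prop
  have hset : {ω | ENNReal.ofReal T ≤ sinrMRC ∞ d α x g h ω}ᶜ =
      (fun ω => (interferencePair d α x h T ω, (g 0 ω, g 1 ω))) ⁻¹' U := by
    ext ω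
    have hT0 := ENNReal.ofReal_pos.2 hT
    rw [Set.mem_compl_iff, Set.mem_ofPred_eq, not_le]
    have e : ∀ (r : ℝ) (I : ℝ≥0∞), ENNReal.ofReal r / (ENNReal.ofReal T * I) =
        ENNReal.ofReal r / I / ENNReal.ofReal T := fun r I => by
      rw [div_eq_mul_inv, div_eq_mul_inv, div_eq_mul_inv, mul_assoc, mul_comm I⁻¹,
        ENNReal.mul_inv (Or.inl hT0.ne') (Or.inl ENNReal.ofReal_ne_top)]
    change _ ↔ ENNReal.ofReal (g 0 ω) / (ENNReal.ofReal T * interference d α x (h 0) ω) +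
      ENNReal.ofReal (g 1 ω) / (ENNReal.ofReal T * interference d α x (h 1) ω) < 1
    rw [e, e, ENNReal.div_add_div_same, ENNReal.div_lt_iff (Or.inl hT0.ne')
      (Or.inl ENNReal.ofReal_ne_top), one_mul]
    simp only [sinrMRC, Fin.sum_univ_two, ENNReal.inv_top, add_zero]
  have hmeas : MeasurableSet {ω | ENNReal.ofReal T ≤ sinrMRC ∞ d α x g h ω} := by
    rw [← MeasurableSet.compl_iff, hset]
    exact (hS.prodMk hg) hU
  rw [successProb, ← probReal_compl_eq_one_sub hmeas, hset,
    ← map_measureReal_apply (hS.prodMk hg) hU, hjoint, measureReal_def, Measure.prod_apply hU,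
    integral_eq_lintegral_of_nonneg_ae (ae_of_all _ condOutage_nonneg)
      (continuous_condOutage hmD).measurable.aestronglyMeasurable]
  congr 1
  exact lintegral_congr fun s => (ofReal_measureReal (s := outageSet s)).symm

end Outage

/-! ### The limit of the rescaled outage probability -/

section Limit

/-- This is the derivative of `1 - exp (-(u c))` at `u = 0`, taken along `u = T^δ`. -/
theorem tendsto_rpow_neg_mul_one_sub_exp {δ : ℝ} (hδ : 0 < δ) (c : ℝ) :
    Tendsto (fun T : ℝ => T ^ (-δ) * (1 - Real.exp (-(T ^ δ * c)))) (𝓝[>] 0) (𝓝 c) := by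
  have hd : HasDerivAt (fun u : ℝ => 1 - Real.exp (-(u * c))) c 0 := by
    have := (((hasDerivAt_id (0 : ℝ)).mul_const c).neg.exp).const_sub 1
    simpa using this
  have h1 := (hasDerivAt_iff_tendsto_slope_zero.1 hd).mono_left (nhdsGT_le_nhdsNE 0)
  have h2 : Tendsto (fun T : ℝ => T ^ δ) (𝓝[>] 0) (𝓝[>] 0) := by
    refine tendsto_nhdsWithin_iff.2 ⟨?_, ?_⟩
    · have : ContinuousAt (fun T : ℝ => T ^ δ) 0 :=
        Real.continuousAt_rpow_const _ _ (Or.inr hδ.le)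
      have h0 := this.tendsto
      rw [Real.zero_rpow hδ.ne'] at h0
      exact h0.mono_left nhdsWithin_le_nhds
    · filter_upwards [self_mem_nhdsWithin] with T hT using Real.rpow_pos_of_pos hT _
  refine (h1.comp h2).congr' ?_
  filter_upwards [self_mem_nhdsWithin] with T hT
  have hT : 0 < T := hT
  simp [Real.rpow_neg hT.le]

variable {Ω : Type*} [MeasurableSpace Ω] {P : Measure Ω} {lam d α mI : ℝ} {mD : ℕ}
  {x : ℕ → Ω → EuclideanSpace ℝ (Fin 2)} {g : Fin 2 → Ω → ℝ} {h : Fin 2 → ℕ → Ω → ℝ}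

theorem singleAntennaTerm_sub_dualBranchGain (T : ℝ) :
    singleAntennaTerm lam d α mI mD T - dualBranchGain lam d α mI mD T =
      T ^ (2 / α) * (kappa lam d α mI mD * ratioMoment α mI mD) := by
  rw [singleAntennaTerm, dualBranchGain, ratioMoment]
  ring

theorem tendsto_outage [IsProbabilityMeasure P] (hlam : 0 < lam) (hd : 0 < d) (hα : 2 < α)
    (hmI : 0 < mI) (hmD : 1 ≤ mD) (hnet : IsNetwork P 2 lam mI mD x g h) :
    Tendsto (fun T : ℝ => T ^ (-(2 / α)) * (1 - successProb P ∞ d α x g h T)) (𝓝[>] 0)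
      (𝓝 (kappa lam d α mI mD * ratioMoment α mI mD)) := by
  have hδ : 0 < 2 / α := by positivity
  have hS : ∀ T, Measurable (interferencePair d α x h T) := fun T =>
    measurable_interferencePair hnet.poisson.measurable hnet.measurable_h T
  have hind : iIndepFun (fun p : Fin 2 × ℕ => h p.1 p.2) P :=
    hnet.indep_fading.precomp (g := Sum.inr) Sum.inr_injective
  have hxh : IndepFun (fun ω i => x i ω) (fun ω (p : Fin 2 × ℕ) => h p.1 p.2 ω) P :=
    hnet.indep_locations.comp (φ := id)
      (ψ := fun f : Fin 2 ⊕ (Fin 2 × ℕ) → ℝ => fun p : Fin 2 × ℕ => f (Sum.inr p))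
      measurable_id (by fun_prop)
  have hc : (0 : ℝ) ≤ lam * d ^ 2 := by positivity
  have key := tendsto_of_tendsto_laplace (l := 𝓝[>] (0 : ℝ))
    (m := fun T => P.map (interferencePair d α x h T))
    (ν := ENNReal.ofReal (lam * d ^ 2) • pairIntensity α mI) (ρ := fun T => T ^ (-(2 / α)))
    (by filter_upwards [self_mem_nhdsWithin] with T hT using Real.rpow_nonneg (le_of_lt hT) _)
    (fun j k => (integrable_one_sub_expNeg_pairIntensity hα hmI j k).smul_measure
      ENNReal.ofReal_ne_top)
    (fun j k => by
      rw [integral_smul_measure, ENNReal.toReal_ofReal hc, smul_eq_mul]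
      refine (tendsto_rpow_neg_mul_one_sub_exp hδ _).congr' ?_
      filter_upwards [self_mem_nhdsWithin] with T hT
      have hm : Measurable fun s : ℝ≥0∞ × ℝ≥0∞ => expNeg (j * s.1 + k * s.2) := by fun_prop
      have hi : Integrable (fun ω => expNeg (j * (interferencePair d α x h T ω).1 +
          k * (interferencePair d α x h T ω).2)) P :=
        integrable_expNeg (((hS T).fst.const_mul _).add ((hS T).snd.const_mul _)).aemeasurable
      have hlt := integral_expNeg_interferencePair hα hlam hd hmI hnet.poisson hnet.measurable_h
        hnet.law_h hind hxh hT j k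
      rw [integral_map (hS T).aemeasurable (hm.const_sub 1).aestronglyMeasurable]
      rw [integral_sub (μ := P) (integrable_const _) hi, hlt, mul_assoc (T ^ (2 / α))]
      simp)
    (condOutageQuotient hmD)
  simp_rw [condOutageQuotient_mul] at key
  rw [integral_smul_measure, ENNReal.toReal_ofReal hc, smul_eq_mul,
    integral_condOutage_pairIntensity hα hmI hmD] at key
  have e : lam * d ^ 2 * (Real.pi * ((mD : ℝ) / mI) ^ (2 / α) * ratioMoment α mI mD) =
      kappa lam d α mI mD * ratioMoment α mI mD := by
    rw [kappa]
    ring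
  rw [e] at key
  refine key.congr' ?_
  filter_upwards [self_mem_nhdsWithin] with T hT
  rw [one_sub_successProb hmD hnet hT]

end Limit

end DualMRC

/-! ### The asymptotic equivalences -/

theorem mainTheorem2 {Ω : Type*} [MeasurableSpace Ω] (P : Measure Ω) [IsProbabilityMeasure P]
    (lam d α mI : ℝ) (mD : ℕ) (hlam : 0 < lam) (hd : 0 < d) (hα : 2 < α) (hmI : 0 < mI)
    (hmD : 1 ≤ mD)
    (x : ℕ → Ω → EuclideanSpace ℝ (Fin 2)) (g : Fin 2 → Ω → ℝ) (h : Fin 2 → ℕ → Ω → ℝ)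
    (hnet : DualMRC.IsNetwork P 2 lam mI mD x g h) :
    (∀ k < mD, IntegrableOn (DualMRC.coeffIntegrand α mI mD k) (Set.Ioo (0 : ℝ) 1)) ∧
    (fun T : ℝ => DualMRC.successProb P ∞ d α x g h T) ~[𝓝[>] (0 : ℝ)]
      (fun T : ℝ => 1 - DualMRC.singleAntennaTerm lam d α mI mD T
        + DualMRC.dualBranchGain lam d α mI mD T) ∧
    (fun T : ℝ => 1 - DualMRC.successProb P ∞ d α x g h T) ~[𝓝[>] (0 : ℝ)]
      (fun T : ℝ => DualMRC.singleAntennaTerm lam d α mI mD T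
        - DualMRC.dualBranchGain lam d α mI mD T) := by
  have hδ : 0 < 2 / α := by positivity
  set L := DualMRC.kappa lam d α mI mD * DualMRC.ratioMoment α mI mD with hL
  have hL0 : 0 < L := by
    have := DualMRC.ratioMoment_pos hα hmI hmD
    rw [hL, DualMRC.kappa]
    positivity
  have key := DualMRC.tendsto_outage hlam hd hα hmI hmD hnet
  rw [← hL] at key
  have hrpow : Tendsto (fun T : ℝ => T ^ (2 / α)) (𝓝[>] 0) (𝓝 0) := by
    have h0 := (Real.continuousAt_rpow_const 0 (2 / α) (Or.inr hδ.le)).tendsto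
    rw [Real.zero_rpow hδ.ne'] at h0
    exact h0.mono_left nhdsWithin_le_nhds
  have hbracket : Tendsto (fun T : ℝ => T ^ (2 / α) * L) (𝓝[>] 0) (𝓝 0) := by
    simpa using hrpow.mul_const L
  have hout : (fun T : ℝ => 1 - DualMRC.successProb P ∞ d α x g h T) ~[𝓝[>] (0 : ℝ)]
      (fun T : ℝ => T ^ (2 / α) * L) := by
    refine isEquivalent_of_tendsto_one ?_
    have h1 := key.div_const L
    rw [div_self hL0.ne'] at h1
    refine h1.congr' ?_
    filter_upwards [self_mem_nhdsWithin] with T hT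
    have hT : 0 < T := hT
    rw [Pi.div_apply, Real.rpow_neg hT.le]
    field_simp
  refine ⟨fun k hk => DualMRC.integrableOn_coeffIntegrand hα hmI hmD hk, ?_, ?_⟩
  -- Here both sides merely tend to `1`; the coefficient of `T^(2/α)` is captured by the outage
  -- equivalence `hout`.
  · have h1 : Tendsto (fun T : ℝ => DualMRC.successProb P ∞ d α x g h T) (𝓝[>] 0) (𝓝 1) := by
      have := (hout.symm.tendsto_nhds hbracket).const_sub 1
      simpa using this
    have h2 : Tendsto (fun T : ℝ => 1 - DualMRC.singleAntennaTerm lam d α mI mD T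
        + DualMRC.dualBranchGain lam d α mI mD T) (𝓝[>] 0) (𝓝 1) := by
      have h3 := hbracket.const_sub 1
      rw [sub_zero] at h3
      refine h3.congr fun T => ?_
      rw [hL, ← DualMRC.singleAntennaTerm_sub_dualBranchGain]
      ring
    exact ((isEquivalent_const_iff_tendsto one_ne_zero).2 h1).trans
      ((isEquivalent_const_iff_tendsto one_ne_zero).2 h2).symm
  · simp_rw [DualMRC.singleAntennaTerm_sub_dualBranchGain]
    exact hout
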